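/- Let $\mathbb{T}=\mathbb{R}/2\pi\mathbb{Z}$. For $s\ge 0$ let $H^s_0(\mathbb{T})$ be the space of real-valued $u\in L^2(\mathbb{T})$ with $\int_{\mathbb{T}}u\,dx=0$ and $$\|u\|_s^2=\sum_{k\in\mathbb{Z}}(1+|k|)^{2s}|\widehat u(k)|^2<\infty,\qquad \widehat u(k)=\frac1{2\pi}\int_0^{2\pi}u(x)e^{-ikx}\,dx .$$ Let $\alpha<0$ and $\mu,\zeta,\eta\in\mathbb{R}$. Let $g\in C^\infty(\mathbb{T};\mathbb{R})$ satisfy $g\ge 0$ and $\int_{\mathbb{T}}g\,dx=1$, and put $$(G\ell)(x,t)=g(x)\Big(\ell(x,t)-\int_{\mathbb{T}}g(y)\,\ell(y,t)\,dy\Big).$$ **Theorem.** Let $T>0$ and $s\ge 0$. For any $(u_0,v_0),(u_1,v_1)\in H^s_0(\mathbb{T})\times H^s_0(\mathbb{T})$ there exist controls $f,h\in L^2(0,T;H^s_0(\mathbb{T}))$ such that the system $$\begin{cases}\partial_t u+\partial_x^3u+\mu\,\partial_xu+\eta\,\partial_xv=Gf,\\ \partial_t v+\alpha\,\partial_x^3v+\zeta\,\partial_xv+\eta\,\partial_xu=Gh,\\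 (u,v)(\cdot,0)=(u_0,v_0),\end{cases}\qquad x\in\mathbb{T},\ t\in[0,T],$$ has a solution $(u,v)\in C([0,T];H^s_0(\mathbb{T}))\times C([0,T];H^s_0(\mathbb{T}))$ with $(u,v)(\cdot,T)=(u_1,v_1)$. Here $(u,v)$ is a solution in the weak sense: for every $\varphi\in C^\infty(\mathbb{T};\mathbb{R})$ and every $t\in[0,T]$, with $\langle w,\varphi\rangle=\int_{\mathbb{T}}w\varphi\,dx$, $$\langle u(t),\varphi\rangle=\langle u(0),\varphi\rangle+\int_0^t\Big(\langle u,\varphi'''\rangle+\mu\langle u,\varphi'\rangle+\eta\langle v,\varphi'\rangle+\langle Gf,\varphi\rangle\Big)d\tau,$$ $$\langle v(t),\varphi\rangle=\langle v(0),\varphi\rangle+\int_0^t\Big(\alpha\langle v,\varphi'''\rangle+\zeta\langle v,\varphi'\rangle+\eta\langle u,\varphi'\rangle+\langle Gh,\varphi\rangle\Big)d\tau .$$ -/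

import Mathlib

open MeasureTheory Set
open scoped Real ContDiff

namespace CoupledKdV

instance instFactTwoPiPos : Fact (0 < 2 * π) := ⟨Real.two_pi_pos⟩

/-- The one-dimensional torus `ℝ / 2πℤ`.  Its `volume` is the measure `dx`, of total mass `2π`. -/
abbrev Torus : Type := AddCircle (2 * π)

/-- Classes of real-valued square integrable functions on the torus.  The normalised Haar measure
`dx / 2π` is used only to form these classes, which are the same as for `dx`. -/
abbrev L2Torus : Type := Lp ℝ 2 (AddCircle.haarAddCircle : Measure Torus)

/-- The Fourier coefficient `(1 / 2π) ∫ f(x) exp(-ikx) dx`. -/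
noncomputable def fhat (f : L2Torus) (k : ℤ) : ℂ :=
  fourierCoeff (fun x : Torus => ((f x : ℝ) : ℂ)) k

/-- The Bessel weight `⟨k⟩ ^ s`, with `⟨k⟩ = 1 + |k|`. -/
noncomputable def weight (s : ℝ) (k : ℤ) : ℝ := (1 + |(k : ℝ)|) ^ s

theorem weight_pos (s : ℝ) (k : ℤ) : 0 < weight s k :=
  Real.rpow_pos_of_pos (by positivity) s

theorem memLp_ofReal (f : L2Torus) :
    MemLp (fun x : Torus => ((f x : ℝ) : ℂ)) 2 AddCircle.haarAddCircle :=
  (Lp.memLp f).ofReal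

theorem integrable_ofReal (f : L2Torus) :
    Integrable (fun x : Torus => ((f x : ℝ) : ℂ)) AddCircle.haarAddCircle :=
  (memLp_ofReal f).integrable (by norm_num)

theorem fhat_add (f g : L2Torus) (k : ℤ) : fhat (f + g) k = fhat f k + fhat g k := by
  have h : (fun x : Torus => (((f + g : L2Torus) x : ℝ) : ℂ))
      =ᵐ[AddCircle.haarAddCircle]
      (fun x : Torus => ((f x : ℝ) : ℂ)) + (fun x : Torus => ((g x : ℝ) : ℂ)) := by
    filter_upwards [Lp.coeFn_add f g] with x hx
    rw [hx]
    simp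
  unfold fhat
  rw [fourierCoeff_congr_ae h, fourierCoeff.add (integrable_ofReal f) (integrable_ofReal g)]
  rfl

theorem fhat_smul (c : ℝ) (f : L2Torus) (k : ℤ) : fhat (c • f) k = (c : ℂ) * fhat f k := by
  have h : (fun x : Torus => (((c • f : L2Torus) x : ℝ) : ℂ))
      =ᵐ[AddCircle.haarAddCircle] (fun x : Torus => (c : ℂ) * ((f x : ℝ) : ℂ)) := by
    filter_upwards [Lp.coeFn_smul c f] with x hx
    rw [hx]
    simp
  unfold fhat
  rw [fourierCoeff_congr_ae h, fourierCoeff.const_mul]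

theorem fhat_zero (k : ℤ) : fhat 0 k = 0 := by
  simpa using fhat_smul 0 (0 : L2Torus) k

/-- An `L²` function on the torus is determined by its Fourier coefficients. -/
theorem eq_zero_of_fhat (f : L2Torus) (hf : ∀ k, fhat f k = 0) : f = 0 := by
  have h0 : (memLp_ofReal f).toLp _ = 0 := by
    apply (fourierBasis (T := 2 * π)).repr.injective
    ext k
    rw [fourierBasis_repr, fourierCoeff_congr_ae (MemLp.coeFn_toLp (memLp_ofReal f))]
    simpa [fhat] using hf k
  have h1 := MemLp.coeFn_toLp (memLp_ofReal f)
  rw [h0] at h1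
  rw [Lp.eq_zero_iff_ae_eq_zero]
  filter_upwards [h1, Lp.coeFn_zero ℂ 2 (AddCircle.haarAddCircle : Measure Torus)] with x hx hx0
  rw [hx0] at hx
  simpa using hx.symm

/-- Membership in `H^s₀`: finite Sobolev norm and zero mean.  For `s ≥ 0`, every periodic
distribution with finite `H^s` norm is an `L²` function, so nothing is lost by starting in `L²`. -/
def MemHsZero (s : ℝ) (f : L2Torus) : Prop :=
  Memℓp (fun k : ℤ => ((weight s k : ℝ) : ℂ) * fhat f k) 2 ∧ ∫ x : Torus, f x = 0

theorem integral_volume_eq (F : Torus → ℝ) :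
    ∫ x : Torus, F x = (2 * π) * ∫ x : Torus, F x ∂AddCircle.haarAddCircle := by
  rw [AddCircle.integral_haarAddCircle, smul_eq_mul, ← mul_assoc,
    mul_inv_cancel₀ Real.two_pi_pos.ne', one_mul]

/-- The subspace of `L²` underlying `H^s₀`. -/
def hsZeroSubmodule (s : ℝ) : Submodule ℝ L2Torus where
  carrier := {f | MemHsZero s f}
  zero_mem' := by
    refine ⟨?_, ?_⟩
    · simp only [fhat_zero, mul_zero]
      exact zero_memℓp
    · rw [integral_volume_eq, integral_congr_ae (Lp.coeFn_zero ℝ 2 _)]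
      simp
  add_mem' := by
    rintro f g ⟨hf, hf0⟩ ⟨hg, hg0⟩
    refine ⟨?_, ?_⟩
    · convert hf.add hg using 1
      ext k
      simp only [fhat_add, Pi.add_apply]
      ring
    · rw [integral_volume_eq] at hf0 hg0 ⊢
      have hfi : Integrable f (AddCircle.haarAddCircle : Measure Torus) :=
        (Lp.memLp f).integrable (by norm_num)
      have hgi : Integrable g (AddCircle.haarAddCircle : Measure Torus) :=
        (Lp.memLp g).integrable (by norm_num)
      rw [integral_congr_ae (Lp.coeFn_add f g), integral_add' hfi hgi, mul_add, hf0, hg0, add_zero]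
  smul_mem' := by
    rintro c f ⟨hf, hf0⟩
    refine ⟨?_, ?_⟩
    · convert hf.const_smul (c : ℂ) using 1
      ext k
      simp only [fhat_smul, Pi.smul_apply, smul_eq_mul]
      ring
    · rw [integral_volume_eq] at hf0 ⊢
      rw [integral_congr_ae (Lp.coeFn_smul c f)]
      simp only [Pi.smul_apply, smul_eq_mul, integral_const_mul]
      rw [mul_left_comm, hf0, mul_zero]

/-- The Sobolev space `H^s₀` of real-valued functions with zero mean on the torus.  It is a type of
its own because it carries the `H^s` norm, not the norm of `L²`. -/
def HsZero (s : ℝ) : Type := hsZeroSubmodule s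

noncomputable instance instAddCommGroupHsZero (s : ℝ) : AddCommGroup (HsZero s) :=
  inferInstanceAs (AddCommGroup (hsZeroSubmodule s))

noncomputable instance instModuleHsZero (s : ℝ) : Module ℝ (HsZero s) :=
  inferInstanceAs (Module ℝ (hsZeroSubmodule s))

/-- The class in `L²` of an element of `H^s₀`. -/
def HsZero.toL2 {s : ℝ} (f : HsZero s) : L2Torus := f.1

/-- An element of `H^s₀` as a function on the torus (defined almost everywhere). -/
noncomputable instance instCoeFunHsZero (s : ℝ) : CoeFun (HsZero s) (fun _ => Torus → ℝ) :=
  ⟨fun f => (f.toL2 : Torus → ℝ)⟩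

/-- The Fourier multiplier `f ↦ (⟨k⟩ ^ s * fhat f k)_k` from `H^s₀` to `ℓ²`. -/
noncomputable def besselCoeff (s : ℝ) : HsZero s →ₗ[ℝ] lp (fun _ : ℤ => ℂ) 2 where
  toFun f := ⟨fun k : ℤ => ((weight s k : ℝ) : ℂ) * fhat f.toL2 k, f.2.1⟩
  map_add' f g := by
    ext k
    change ((weight s k : ℝ) : ℂ) * fhat (f.toL2 + g.toL2) k = _
    rw [fhat_add, mul_add]
    rfl
  map_smul' c f := by
    ext k
    change ((weight s k : ℝ) : ℂ) * fhat (c • f.toL2) k =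
      c • (((weight s k : ℝ) : ℂ) * fhat f.toL2 k)
    rw [fhat_smul, Complex.real_smul]
    ring

theorem besselCoeff_injective (s : ℝ) : Function.Injective (besselCoeff s) := by
  rw [← LinearMap.ker_eq_bot, LinearMap.ker_eq_bot']
  intro f hf
  apply Subtype.ext
  refine eq_zero_of_fhat f.toL2 fun k => ?_
  have h : ((weight s k : ℝ) : ℂ) * fhat f.toL2 k = 0 := congrArg (fun a => a.1 k) hf
  exact (mul_eq_zero.mp h).resolve_left (by exact_mod_cast (weight_pos s k).ne')

/-- The `H^s` norm: the `ℓ²` norm of the weighted Fourier coefficients. -/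
noncomputable instance instNormedAddCommGroupHsZero (s : ℝ) : NormedAddCommGroup (HsZero s) :=
  NormedAddCommGroup.induced (HsZero s) (lp (fun _ : ℤ => ℂ) 2) (besselCoeff s)
    (besselCoeff_injective s)

noncomputable instance instNormedSpaceHsZero (s : ℝ) : NormedSpace ℝ (HsZero s) :=
  NormedSpace.induced ℝ (HsZero s) (lp (fun _ : ℤ => ℂ) 2) (besselCoeff s)

/-- The norm is `‖f‖² = ∑ₖ (1 + |k|)^(2s) |fhat f k|²`. -/
theorem HsZero.norm_sq_eq {s : ℝ} (f : HsZero s) :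
    ‖f‖ ^ 2 = ∑' k : ℤ, (1 + |(k : ℝ)|) ^ (2 * s) * ‖fhat f.toL2 k‖ ^ 2 := by
  have h := lp.norm_rpow_eq_tsum (p := 2) (by norm_num) (besselCoeff s f)
  have h2 : (2 : ENNReal).toReal = ((2 : ℕ) : ℝ) := by norm_num
  rw [h2, Real.rpow_natCast] at h
  change ‖besselCoeff s f‖ ^ 2 = _
  rw [h]
  refine tsum_congr fun k => ?_
  rw [Real.rpow_natCast]
  change ‖((weight s k : ℝ) : ℂ) * fhat f.toL2 k‖ ^ 2 = _
  have hw : weight s k ^ 2 = (1 + |(k : ℝ)|) ^ (2 * s) := by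
    rw [weight, ← Real.rpow_natCast, ← Real.rpow_mul (by positivity)]
    congr 1
    push_cast
    ring
  rw [norm_mul, Complex.norm_real, Real.norm_of_nonneg (weight_pos s k).le, mul_pow, hw]

/-- Smooth functions on the torus: those with a smooth (periodic) lift to the line. -/
def IsSmooth (φ : Torus → ℝ) : Prop := ContDiff ℝ ∞ (fun x : ℝ => φ (x : Torus))

/-- The derivative of a function on the torus. -/
noncomputable def dx (φ : Torus → ℝ) : Torus → ℝ :=
  fun θ => deriv (fun x : ℝ => φ (θ + (x : Torus))) 0

/-- On lifts to the line, `dx` is the usual derivative. -/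
theorem dx_coe (φ : Torus → ℝ) (y : ℝ) :
    dx φ (y : Torus) = deriv (fun x : ℝ => φ (x : Torus)) y := by
  have h : (fun x : ℝ => φ ((y : Torus) + (x : Torus))) = fun x : ℝ => φ ((y + x : ℝ) : Torus) := by
    ext x
    rw [AddCircle.coe_add]
  rw [dx, h, deriv_comp_const_add (fun x : ℝ => φ (x : Torus)) y 0, add_zero]

/-- The pairing `∫ w φ dx` over the torus. -/
noncomputable def pairing (w φ : Torus → ℝ) : ℝ := ∫ x : Torus, w x * φ x

/-- The control operator `(G ℓ)(x) = g(x) (ℓ(x) - ∫ g(y) ℓ(y) dy)`. -/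
noncomputable def controlOp (g ℓ : Torus → ℝ) : Torus → ℝ :=
  fun x => g x * (ℓ x - ∫ y : Torus, g y * ℓ y)

/-- Admissible profiles of the control operator: smooth, nonnegative, with integral one. -/
structure IsControlProfile (g : Torus → ℝ) : Prop where
  smooth : IsSmooth g
  nonneg : ∀ x, 0 ≤ g x
  integral_eq_one : ∫ x : Torus, g x = 1

/-- `(u, v)` is a weak solution on `[0, T]` of
`∂ₜ u + ∂ₓ³ u + μ ∂ₓ u + η ∂ₓ v = G f` and `∂ₜ v + α ∂ₓ³ v + ζ ∂ₓ v + η ∂ₓ u = G h`: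
both equations, integrated in time, hold when tested against every smooth function on the torus,
the space derivatives being moved to the test function. -/
def IsWeakSolution {s : ℝ} (α μ ζ η : ℝ) (g : Torus → ℝ) (T : ℝ) (f h u v : ℝ → HsZero s) :
    Prop :=
  ∀ φ : Torus → ℝ, IsSmooth φ → ∀ t ∈ Icc 0 T,
    pairing (u t) φ = pairing (u 0) φ + ∫ τ in 0..t,
      (pairing (u τ) (dx (dx (dx φ))) + μ * pairing (u τ) (dx φ) + η * pairing (v τ) (dx φ)
        + pairing (controlOp g (f τ)) φ) ∧
    pairing (v t) φ = pairing (v 0) φ + ∫ τ in 0..t,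
      (α * pairing (v τ) (dx (dx (dx φ))) + ζ * pairing (v τ) (dx φ) + η * pairing (u τ) (dx φ)
        + pairing (controlOp g (h τ)) φ)

end CoupledKdV

open CoupledKdV

/-! The proof is the Hilbert uniqueness method on the Fourier side. In the coefficients weighted by
`weight s k` the system becomes x' = iMx + (control) on ℓ²(ℤ × {0,1}), where M acts on frequency k
by a real symmetric 2 × 2 matrix M_k. Let S(t) = exp(itM) and let G be the matrix of the control
operator. With the control S(t)y, Duhamel's formula gives x(t) = S(t)(x₀ + Λ_t y), where Λ_t = ∫₀ᵗ
S(-τ) G S(τ) dτ. It is therefore enough that the Gramian Λ_T be surjective (`gram_kdv_surjective`).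

Λ_T is a nonzero scalar plus a compact operator (`exists_compact_gram`). Its blocks are γ(l,k)
X(l,k), with γ the matrix of G and X(l,k) = ∫₀ᵀ exp(-itM_l) exp(itM_k) dt. On the diagonal X(k,k) =
T, and γ(k,k) tends to ĝ(0) = 1/(2π). Off the diagonal X solves a Sylvester equation whose leading
coefficients are ak³ - bl³ with a, b ∈ {1, α}. As α < 0, these are at least c(k² + l²) when kl > 0,
so X gains a factor 1/(1 + |l|). When kl ≤ 0 resonances may occur, but then |l| ≤ |l - k| and the
rapid decay of γ away from the diagonal pays for the same factor (`exists_norm_cross_kdv_le`).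

By the Fredholm alternative only injectivity remains, and diagonal weights intertwine the Gramian
for s with that for s = 0. There G is symmetric and nonnegative, with form ∫ g|f - m|² for m = ∫ g
f, plus the squared modulus of the zero coefficient (`inner_control_eq`). If Λ_T x = 0, then G S(t)x
= 0 on [0,T], so a short orbit of x lies in the kernel of Λ_{T/2}, which is finite dimensional. Each
eigenvalue of the group is taken at finitely many frequencies, so x has finite support
(`finite_support_of_orbit`). Then x describes trigonometric polynomials constant on the open set
where g ≠ 0, hence constant, hence zero (`eq_zero_of_control_eq_zero`).

The vector y so obtained is complex. Taking real parts and removing the mean commutes with the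
evolution and with G and fixes the prescribed end states, so it yields the real solution in H^s₀
(`isWeakSolution_realize`). -/

namespace CoupledKdV

/-- Square summable complex families. -/
abbrev EllTwo (ι : Type*) : Type _ := lp (fun _ : ι => ℂ) 2

/-! ### Operators on square summable families and their matrices -/

section SquareSummable

variable {ι κ : Type*}

theorem sum_sq_le_norm_sq (x : EllTwo ι) (s : Finset ι) : ∑ i ∈ s, ‖x i‖ ^ 2 ≤ ‖x‖ ^ 2 := by
  have h := lp.sum_rpow_le_norm_rpow (p := 2) (by norm_num) x s
  simpa using h

theorem memℓp_two_iff {x : ι → ℂ} : Memℓp x 2 ↔ Summable fun i => ‖x i‖ ^ 2 := by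
  rw [memℓp_gen_iff (by norm_num)]
  simp

theorem memℓp_two_of_sum_sq_le {x : ι → ℂ} {C : ℝ} (h : ∀ s : Finset ι, ∑ i ∈ s, ‖x i‖ ^ 2 ≤ C) :
    Memℓp x 2 :=
  memℓp_gen' (C := C) (by simpa using h)

theorem norm_le_of_sum_sq_le (x : EllTwo ι) {C : ℝ} (hC : 0 ≤ C)
    (h : ∀ s : Finset ι, ∑ i ∈ s, ‖x i‖ ^ 2 ≤ C ^ 2) : ‖x‖ ≤ C :=
  lp.norm_le_of_forall_sum_le (by norm_num) hC (by simpa using h)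

theorem sum_sq_comp_le (x : EllTwo κ) {e : ι → κ} (he : Function.Injective e) {a : ι → ℂ} {C : ℝ}
    (ha : ∀ i, ‖a i‖ ≤ C) (s : Finset ι) :
    ∑ i ∈ s, ‖a i * x (e i)‖ ^ 2 ≤ (C * ‖x‖) ^ 2 := by
  calc ∑ i ∈ s, ‖a i * x (e i)‖ ^ 2 ≤ ∑ i ∈ s, C ^ 2 * ‖x (e i)‖ ^ 2 := by
        refine Finset.sum_le_sum fun i _ => ?_
        rw [norm_mul, mul_pow]
        gcongr
        exact ha i
    _ = C ^ 2 * ∑ k ∈ s.map ⟨e, he⟩, ‖x k‖ ^ 2 := by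
        rw [Finset.sum_map, Finset.mul_sum]
        rfl
    _ ≤ C ^ 2 * ‖x‖ ^ 2 := by
        gcongr
        exact sum_sq_le_norm_sq x _
    _ = _ := by ring

/-- The operator `x ↦ (a i * x (e i))ᵢ` for bounded `a` and injective `e`. -/
noncomputable def weightedComp (e : ι → κ) (he : Function.Injective e) (a : ι → ℂ) (C : ℝ)
    (hC : 0 ≤ C) (ha : ∀ i, ‖a i‖ ≤ C) : EllTwo κ →L[ℂ] EllTwo ι :=
  LinearMap.mkContinuous
    { toFun := fun x => ⟨fun i => a i * x (e i), memℓp_two_of_sum_sq_le (sum_sq_comp_le x he ha)⟩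
      map_add' := fun x y => by
        ext i
        change a i * (x (e i) + y (e i)) = a i * x (e i) + a i * y (e i)
        ring
      map_smul' := fun c x => by
        ext i
        change a i * (c * x (e i)) = c * (a i * x (e i))
        ring }
    C fun x => norm_le_of_sum_sq_le _ (by positivity) (sum_sq_comp_le x he ha)

theorem weightedComp_apply (e : ι → κ) (he : Function.Injective e) (a : ι → ℂ) (C : ℝ)
    (hC : 0 ≤ C) (ha : ∀ i, ‖a i‖ ≤ C) (x : EllTwo κ) (i : ι) :
    weightedComp e he a C hC ha x i = a i * x (e i) := rfl

theorem norm_weightedComp_le (e : ι → κ) (he : Function.Injective e) (a : ι → ℂ) (C : ℝ)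
    (hC : 0 ≤ C) (ha : ∀ i, ‖a i‖ ≤ C) : ‖weightedComp e he a C hC ha‖ ≤ C :=
  LinearMap.mkContinuous_norm_le _ hC _

/-- Evaluation of a coordinate. -/
noncomputable def coordCLM (i : ι) : EllTwo ι →L[ℂ] ℂ := lp.evalCLM ℂ (fun _ : ι => ℂ) 2 i

@[simp] theorem coordCLM_apply (i : ι) (x : EllTwo ι) : coordCLM i x = x i := rfl

variable [DecidableEq ι]

/-- The standard unit vectors. -/
noncomputable def unitVec (i : ι) : EllTwo ι := lp.single 2 i (1 : ℂ)

theorem unitVec_apply (i j : ι) : unitVec i j = if j = i then 1 else 0 := by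
  rw [unitVec, lp.single_apply]
  by_cases h : j = i
  · subst h; simp
  · simp [h]

theorem hasSum_unitVec (x : EllTwo ι) : HasSum (fun i => x i • unitVec i) x := by
  have h := lp.hasSum_single (p := 2) (by norm_num) x
  convert h using 2 with i
  rw [unitVec, ← lp.single_smul, smul_eq_mul, mul_one]

theorem clm_ext_unitVec {E : Type*} [NormedAddCommGroup E] [NormedSpace ℂ E]
    {A B : EllTwo ι →L[ℂ] E} (h : ∀ i, A (unitVec i) = B (unitVec i)) : A = B := by
  ext x
  have hA := (hasSum_unitVec x).mapL A
  have hB := (hasSum_unitVec x).mapL B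
  simp only [map_smul, h] at hA hB
  exact hA.unique hB

theorem inner_unitVec_left (i : ι) (x : EllTwo ι) : inner ℂ (unitVec i) x = x i := by
  rw [unitVec, lp.inner_single_left]
  simp

/-- The coordinates of `A x` in terms of the matrix entries of `A`. -/
theorem hasSum_entries (A : EllTwo ι →L[ℂ] EllTwo ι) (x : EllTwo ι) (i : ι) :
    HasSum (fun j => A (unitVec j) i * x j) (A x i) := by
  have h := (hasSum_unitVec x).mapL ((coordCLM i).comp A)
  simpa [mul_comm] using h

/-- The unit vectors span a dense subspace, so conjugate transposed entries identify the adjoint.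
This gives both the symmetry of the control operator and the unitarity of the group. -/
theorem inner_map_eq_of_entries {A B : EllTwo ι →L[ℂ] EllTwo ι}
    (h : ∀ i j, A (unitVec j) i = starRingEnd ℂ (B (unitVec i) j)) (x y : EllTwo ι) :
    inner ℂ (A x) y = inner ℂ x (B y) := by
  have hAB : ContinuousLinearMap.adjoint A = B := by
    refine clm_ext_unitVec fun i => ?_
    ext j
    rw [← inner_unitVec_left j, ContinuousLinearMap.adjoint_inner_right,
      ← inner_conj_symm, inner_unitVec_left, h, Complex.conj_conj]
  rw [← hAB, ContinuousLinearMap.adjoint_inner_right]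

end SquareSummable

/-! ### Matrices dominated by a summable function of the distance to the diagonal -/

section Band

variable {ι : Type*} [AddCommGroup ι]

/-- The operator with matrix `a`, whose entries decay summably away from the diagonal. -/
noncomputable def bandCLM (a : ι → ι → ℂ) (w : ι → ℝ) (h : ∀ i j, ‖a i j‖ ≤ w (i - j)) :
    EllTwo ι →L[ℂ] EllTwo ι :=
  ∑' d, weightedComp (fun i => i - d) (sub_left_injective) (fun i => a i (i - d)) (w d)
    ((norm_nonneg (a d 0)).trans (by simpa using h d 0)) fun i => by simpa using h i (i - d)

variable {a : ι → ι → ℂ} {w : ι → ℝ} (hw : Summable w) (h : ∀ i j, ‖a i j‖ ≤ w (i - j))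

include hw in
theorem summable_bandCLM : Summable fun d => weightedComp (fun i => i - d) (sub_left_injective)
    (fun i => a i (i - d)) (w d) ((norm_nonneg (a d 0)).trans (by simpa using h d 0))
    fun i => by simpa using h i (i - d) :=
  Summable.of_norm_bounded hw fun _ => norm_weightedComp_le ..

include hw in
theorem norm_bandCLM_le : ‖bandCLM a w h‖ ≤ ∑' d, w d :=
  tsum_of_norm_bounded hw.hasSum fun _ => norm_weightedComp_le ..

include hw in
theorem hasSum_bandCLM (x : EllTwo ι) (i : ι) :
    HasSum (fun j => a i j * x j) (bandCLM a w h x i) := by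
  have h1 := (summable_bandCLM hw h).hasSum.mapL
    ((coordCLM i).comp (ContinuousLinearMap.apply ℂ (EllTwo ι) x))
  rw [← (Equiv.subLeft i).hasSum_iff]
  exact h1

include hw in
theorem bandCLM_unitVec [DecidableEq ι] (i j : ι) : bandCLM a w h (unitVec j) i = a i j := by
  have h1 := hasSum_bandCLM hw h (unitVec j) i
  have h2 : HasSum (fun k => a i k * unitVec j k) (a i j) := by
    convert hasSum_ite_eq j (a i j) using 2 with k
    rw [unitVec_apply]
    split_ifs with hk
    · simp [hk]
    · simp
  exact h1.unique h2

end Band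

/-! ### Compact operators and the Fredholm alternative -/

section Compact

variable {ι : Type*}

/-- Diagonal operators with entries tending to zero are compact. -/
theorem isCompactOperator_diagonal {b : ι → ℂ} {C : ℝ} (hC : 0 ≤ C) (hb : ∀ i, ‖b i‖ ≤ C)
    (h0 : Filter.Tendsto b Filter.cofinite (nhds 0)) :
    IsCompactOperator (weightedComp id Function.injective_id b C hC hb) := by
  classical
  have hs : ∀ n : ℕ, {i | 1 / ((n : ℝ) + 1) ≤ ‖b i‖}.Finite := by
    intro n
    have h1 := (tendsto_zero_iff_norm_tendsto_zero.mp h0).eventually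
      (gt_mem_nhds (show (0 : ℝ) < 1 / ((n : ℝ) + 1) by positivity))
    rw [Filter.eventually_cofinite] at h1
    simpa using h1
  -- Finite rank truncations: keeping the entries of modulus at least 1/(n+1) leaves an error of
  -- norm at most 1/(n+1).
  let A : ℕ → EllTwo ι →L[ℂ] EllTwo ι := fun n =>
    ∑ i ∈ (hs n).toFinset, (coordCLM i).smulRight (b i • unitVec i)
  have hA : ∀ n x i, A n x i = if i ∈ (hs n).toFinset then b i * x i else 0 := by
    intro n x i
    rw [← coordCLM_apply, sum_apply, map_sum]
    simp only [ContinuousLinearMap.smulRight_apply, coordCLM_apply, map_smul, unitVec_apply,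
      smul_eq_mul, mul_ite, mul_one, mul_zero]
    rw [Finset.sum_ite_eq]
    simp only [mul_comm]
  refine isCompactOperator_of_tendsto (F := A) (l := Filter.atTop) ?_ (Filter.Eventually.of_forall fun n => ?_)
  · rw [tendsto_iff_norm_sub_tendsto_zero]
    refine squeeze_zero (fun _ => norm_nonneg _) (fun n => ?_) tendsto_one_div_add_atTop_nhds_zero_nat
    refine ContinuousLinearMap.opNorm_le_bound _ (by positivity) fun x => ?_
    refine norm_le_of_sum_sq_le _ (by positivity) fun s => ?_
    have key : ∀ i, (A n - weightedComp id Function.injective_id b C hC hb) x i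
        = (if i ∈ (hs n).toFinset then 0 else -b i) * x (id i) := by
      intro i
      change A n x i - b i * x (id i) = _
      rw [hA]
      split_ifs <;> simp
    simp only [key]
    refine sum_sq_comp_le x Function.injective_id (fun i => ?_) s
    split_ifs with hi
    · simp; positivity
    · simp only [Finite.mem_toFinset, mem_ofPred_eq, not_le] at hi
      simpa using hi.le
  · change A n ∈ compactOperator (RingHom.id ℂ) (EllTwo ι) (EllTwo ι)
    refine Submodule.sum_mem _ fun i _ => ?_
    change IsCompactOperator fun x => coordCLM i x • (b i • unitVec i)
    have h1 : IsCompactOperator ((ContinuousLinearMap.id ℂ ℂ).smulRight (b i • unitVec i)) :=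
      isCompactOperator_of_locallyCompactSpace_rng _
    exact h1.comp_clm (coordCLM i)

end Compact

section Fredholm

variable {E : Type*} [NormedAddCommGroup E] [NormedSpace ℂ E]

/-- Riesz–Schauder: -c is either an eigenvalue of K, which injectivity of cI + K excludes, or in its
resolvent set. -/
theorem surjective_of_injective_of_compact [CompleteSpace E] {A K : E →L[ℂ] E} {c : ℂ} (hc : c ≠ 0)
    (hK : IsCompactOperator K) (hA : A = c • ContinuousLinearMap.id ℂ E + K)
    (hinj : ∀ x, A x = 0 → x = 0) : Function.Surjective A := by
  rcases hK.hasEigenvalue_or_mem_resolventSet (neg_ne_zero.mpr hc) with h | h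
  · obtain ⟨x, hx⟩ := h.exists_hasEigenvector
    refine absurd (hinj x ?_) hx.2
    have h1 : K x = -c • x := Module.End.mem_eigenspace_iff.mp hx.1
    rw [hA]
    simp [h1]
  · rw [spectrum.mem_resolventSet_iff, ← IsUnit.neg_iff,
      ContinuousLinearMap.isUnit_iff_bijective] at h
    convert h.2 using 2
    rw [hA]
    ext x
    simp [Algebra.algebraMap_eq_smul_one]
    abel

/-- On the kernel K acts as -c, so the identity of the kernel is compact. -/
theorem finiteDimensional_ker_of_compact {A K : E →L[ℂ] E} {c : ℂ} (hc : c ≠ 0)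
    (hK : IsCompactOperator K) (hA : A = c • ContinuousLinearMap.id ℂ E + K) :
    FiniteDimensional ℂ (LinearMap.ker (A : E →ₗ[ℂ] E)) := by
  have hV : ∀ v ∈ LinearMap.ker (A : E →ₗ[ℂ] E), K v = -c • v := by
    intro v hv
    have h1 : A v = 0 := hv
    rw [hA] at h1
    simp only [add_apply, smul_apply,
      ContinuousLinearMap.id_apply] at h1
    rw [neg_smul]
    exact eq_neg_of_add_eq_zero_right h1
  have hmem : ∀ v ∈ LinearMap.ker (A : E →ₗ[ℂ] E), (K : E →ₗ[ℂ] E) v ∈ LinearMap.ker (A : E →ₗ[ℂ] E) := by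
    intro v hv
    change K v ∈ _
    rw [hV v hv]
    exact Submodule.smul_mem _ _ hv
  have h1 : IsCompactOperator ((K : E →ₗ[ℂ] E).restrict hmem) :=
    IsCompactOperator.restrict (f := (K : E →ₗ[ℂ] E)) hK hmem A.isClosed_ker
  refine FiniteDimensional.of_isCompactOperator_id (𝕜 := ℂ) ?_
  have h2 := h1.smul ((-c)⁻¹)
  have h3 : (id : LinearMap.ker (A : E →ₗ[ℂ] E) → _)
      = (-c)⁻¹ • ⇑((K : E →ₗ[ℂ] E).restrict hmem) := by
    funext v
    apply Subtype.ext
    change (v : E) = (-c)⁻¹ • K v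
    rw [hV v v.2, inv_smul_smul₀ (neg_ne_zero.mpr hc)]
  rw [h3]
  exact h2

end Fredholm

/-! ### The propagator of a single frequency and the cross integrals -/

/-- Spectral data of a family of real symmetric `2 × 2` symbols, odd in the frequency. -/
structure Dispersion where
  symb : ℤ → Matrix (Fin 2) (Fin 2) ℝ
  lam : ℤ → Fin 2 → ℝ
  proj : ℤ → Fin 2 → Matrix (Fin 2) (Fin 2) ℝ
  lam_neg : ∀ k σ, lam (-k) σ = -lam k σ
  proj_neg : ∀ k σ, proj (-k) σ = proj k σ
  proj_symm : ∀ k σ c d, proj k σ c d = proj k σ d c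
  proj_mul : ∀ k σ σ', proj k σ * proj k σ' = if σ = σ' then proj k σ else 0
  proj_sum : ∀ k, ∑ σ, proj k σ = 1
  symb_eq : ∀ k, symb k = ∑ σ, lam k σ • proj k σ
  abs_proj_le : ∀ k σ c d, |proj k σ c d| ≤ 1
  finite_lam : ∀ r, {k | ∃ σ, lam k σ = r}.Finite

namespace Dispersion

variable (D : Dispersion)

/-- The propagator `exp (i t M)` of a single frequency. -/
noncomputable def prop (k : ℤ) (t : ℝ) : Matrix (Fin 2) (Fin 2) ℂ :=
  ∑ σ, Complex.exp (D.lam k σ * t * Complex.I) • (D.proj k σ).map Complex.ofReal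

theorem prop_apply (k : ℤ) (t : ℝ) (c d : Fin 2) :
    D.prop k t c d = ∑ σ, Complex.exp (D.lam k σ * t * Complex.I) * (D.proj k σ c d : ℂ) := by
  simp [prop, Matrix.add_apply]

theorem map_proj_mul (k : ℤ) (σ σ' : Fin 2) :
    (D.proj k σ).map Complex.ofReal * (D.proj k σ').map Complex.ofReal
      = if σ = σ' then (D.proj k σ).map Complex.ofReal else 0 := by
  have h := congrArg (fun A => A.map Complex.ofRealHom) (D.proj_mul k σ σ')
  rw [Matrix.map_mul] at h
  split_ifs at h ⊢ with hs
  · exact h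
  · rw [Matrix.map_zero _ (map_zero _)] at h
    exact h

theorem sum_map_proj (k : ℤ) : ∑ σ, (D.proj k σ).map Complex.ofReal = 1 := by
  have h := congrArg (fun A => A.map Complex.ofRealHom) (D.proj_sum k)
  rw [Fin.sum_univ_two, Matrix.map_add _ (map_add _),
    Matrix.map_one _ (map_zero _) (map_one _)] at h
  rw [Fin.sum_univ_two]
  exact h

theorem map_symb (k : ℤ) : (D.symb k).map Complex.ofReal
    = ∑ σ, (D.lam k σ : ℂ) • (D.proj k σ).map Complex.ofReal := by
  rw [D.symb_eq]
  ext c d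
  simp [Fin.sum_univ_two]

theorem prop_zero (k : ℤ) : D.prop k 0 = 1 := by
  rw [← D.sum_map_proj k, prop]
  simp

theorem map_proj_mul_prop (k : ℤ) (t : ℝ) (σ : Fin 2) :
    (D.proj k σ).map Complex.ofReal * D.prop k t
      = Complex.exp (D.lam k σ * t * Complex.I) • (D.proj k σ).map Complex.ofReal := by
  simp only [prop, Finset.mul_sum, Matrix.mul_smul, map_proj_mul, smul_ite, smul_zero]
  simp

theorem prop_mul (k : ℤ) (s t : ℝ) : D.prop k s * D.prop k t = D.prop k (s + t) := by
  have h : D.prop k s = ∑ σ, Complex.exp (D.lam k σ * s * Complex.I)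
      • (D.proj k σ).map Complex.ofReal := rfl
  rw [h, Finset.sum_mul, prop.eq_1 D k (s + t)]
  refine Finset.sum_congr rfl fun σ _ => ?_
  rw [Matrix.smul_mul, map_proj_mul_prop, smul_smul, ← Complex.exp_add]
  congr 2
  push_cast
  ring

theorem conj_prop_symm (k : ℤ) (t : ℝ) (c d : Fin 2) :
    starRingEnd ℂ (D.prop k t c d) = D.prop k (-t) d c := by
  simp only [prop_apply, map_sum, map_mul, Complex.conj_ofReal,
    ← Complex.exp_conj, Complex.conj_I]
  refine Finset.sum_congr rfl fun σ _ => ?_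
  rw [D.proj_symm k σ c d]
  push_cast
  simp

theorem norm_prop_le (k : ℤ) (t : ℝ) (c d : Fin 2) : ‖D.prop k t c d‖ ≤ 2 := by
  rw [prop_apply]
  refine (norm_sum_le _ _).trans ?_
  have h : ∀ σ, ‖Complex.exp (D.lam k σ * t * Complex.I) * (D.proj k σ c d : ℂ)‖ ≤ 1 := by
    intro σ
    rw [norm_mul, ← Complex.ofReal_mul, Complex.norm_exp_ofReal_mul_I, one_mul, Complex.norm_real]
    exact D.abs_proj_le k σ c d
  exact (Finset.sum_le_sum fun σ _ => h σ).trans (by simp)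

theorem symb_mul_prop (k : ℤ) (t : ℝ) : (D.symb k).map Complex.ofReal * D.prop k t
    = ∑ σ, (D.lam k σ * Complex.exp (D.lam k σ * t * Complex.I))
      • (D.proj k σ).map Complex.ofReal := by
  rw [map_symb, Finset.sum_mul]
  refine Finset.sum_congr rfl fun σ _ => ?_
  rw [Matrix.smul_mul, map_proj_mul_prop, smul_smul]

theorem prop_mul_symb (k : ℤ) (t : ℝ) : D.prop k t * (D.symb k).map Complex.ofReal
    = (D.symb k).map Complex.ofReal * D.prop k t := by
  rw [symb_mul_prop, map_symb, prop]
  simp only [Finset.mul_sum, Finset.sum_mul, Matrix.smul_mul, Matrix.mul_smul, map_proj_mul,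
    smul_ite, smul_zero]
  simp [smul_smul]

theorem hasDerivAt_prop (k : ℤ) (t : ℝ) (c d : Fin 2) :
    HasDerivAt (fun t => D.prop k t c d)
      (Complex.I * ∑ e, (D.symb k c e : ℂ) * D.prop k t e d) t := by
  have h1 : ∀ σ, HasDerivAt (fun t : ℝ => Complex.exp (D.lam k σ * t * Complex.I))
      (Complex.I * (D.lam k σ * Complex.exp (D.lam k σ * t * Complex.I))) t := by
    intro σ
    have h2 : HasDerivAt (fun t : ℝ => (D.lam k σ * t * Complex.I : ℂ))
        (D.lam k σ * Complex.I) t := by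
      simpa using ((Complex.ofRealCLM.hasDerivAt (x := t)).const_mul
        (D.lam k σ : ℂ)).mul_const Complex.I
    exact h2.cexp.congr_deriv (by ring)
  have h3 := HasDerivAt.fun_sum (u := Finset.univ)
    fun σ _ => (h1 σ).mul_const (D.proj k σ c d : ℂ)
  simp only [D.prop_apply k]
  refine h3.congr_deriv ?_
  symm
  have h4 := congrFun (congrFun (D.symb_mul_prop k t) c) d
  rw [Matrix.mul_apply] at h4
  simp only [Matrix.map_apply, prop_apply] at h4
  rw [h4, Matrix.sum_apply, Finset.mul_sum]
  refine Finset.sum_congr rfl fun σ _ => ?_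
  simp
  ring

theorem continuous_prop (k : ℤ) (c d : Fin 2) : Continuous fun t => D.prop k t c d :=
  continuous_iff_continuousAt.mpr fun t => (D.hasDerivAt_prop k t c d).continuousAt

/-- The time integral over `[0, T]` of `exp (-i t M_l) exp (i t M_k)`. -/
noncomputable def cross (T : ℝ) (l k : ℤ) (c d : Fin 2) : ℂ :=
  ∫ t in (0 : ℝ)..T, (D.prop l (-t) * D.prop k t) c d

theorem norm_prop_mul_prop_le (l k : ℤ) (s t : ℝ) (c d : Fin 2) :
    ‖(D.prop l s * D.prop k t) c d‖ ≤ 8 := by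
  rw [Matrix.mul_apply]
  refine (norm_sum_le _ _).trans ?_
  have h : ∀ e, ‖D.prop l s c e * D.prop k t e d‖ ≤ 4 := by
    intro e
    rw [norm_mul]
    have h1 := D.norm_prop_le l s c e
    have h2 := D.norm_prop_le k t e d
    nlinarith [norm_nonneg (D.prop l s c e), norm_nonneg (D.prop k t e d)]
  exact (Finset.sum_le_sum fun σ _ => h σ).trans (by norm_num)

theorem continuous_prop_mul_prop (l k : ℤ) (c d : Fin 2) :
    Continuous fun t => (D.prop l (-t) * D.prop k t) c d := by
  simp only [Matrix.mul_apply]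
  exact continuous_finsetSum _ fun e _ =>
    ((D.continuous_prop l c e).comp continuous_neg).mul (D.continuous_prop k e d)

theorem norm_cross_le {T : ℝ} (hT : 0 ≤ T) (l k : ℤ) (c d : Fin 2) :
    ‖D.cross T l k c d‖ ≤ 8 * T := by
  have := intervalIntegral.norm_integral_le_of_norm_le_const (a := 0) (b := T) (C := 8)
    (f := fun t => (D.prop l (-t) * D.prop k t) c d)
    fun t _ => D.norm_prop_mul_prop_le l k (-t) t c d
  rw [sub_zero, abs_of_nonneg hT] at this
  exact this

/-- The two exponentials cancel, coupling included. This is where the multiple of the identity in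
the Gramian comes from. -/
theorem cross_self (T : ℝ) (k : ℤ) (c d : Fin 2) :
    D.cross T k k c d = if c = d then (T : ℂ) else 0 := by
  simp only [cross, prop_mul, neg_add_cancel, prop_zero, Matrix.one_apply]
  split_ifs <;> simp

/-- The Sylvester equation of the cross integrals. -/
theorem cross_sylvester (T : ℝ) (l k : ℤ) (c d : Fin 2) :
    (D.prop l (-T) * D.prop k T) c d - (if c = d then 1 else 0)
      = Complex.I * (∑ e, D.cross T l k c e * (D.symb k e d : ℂ)
        - ∑ e, (D.symb l c e : ℂ) * D.cross T l k e d) := by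
  have hd : ∀ t, HasDerivAt (fun t => (D.prop l (-t) * D.prop k t) c d)
      (Complex.I * (∑ e, (D.prop l (-t) * D.prop k t) c e * (D.symb k e d : ℂ)
        - ∑ e, (D.symb l c e : ℂ) * (D.prop l (-t) * D.prop k t) e d)) t := by
    intro t
    have h1 : ∀ e, HasDerivAt (fun t => D.prop l (-t) c e)
        (-(Complex.I * ∑ f, (D.symb l c f : ℂ) * D.prop l (-t) f e)) t := by
      intro e
      have := (D.hasDerivAt_prop l (-t) c e).scomp t (hasDerivAt_neg t)
      rwa [neg_one_smul] at this
    have h2 := HasDerivAt.fun_sum (u := Finset.univ)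
      fun e _ => (h1 e).mul (D.hasDerivAt_prop k t e d)
    have h3 : ∀ e, ∑ f, (D.symb k e f : ℂ) * D.prop k t f d
        = ∑ f, D.prop k t e f * (D.symb k f d : ℂ) := by
      intro e
      have := congrFun (congrFun (D.prop_mul_symb k t) e) d
      simpa [Matrix.mul_apply] using this.symm
    simp only [Matrix.mul_apply]
    refine h2.congr_deriv ?_
    simp only [h3]
    simp only [Fin.sum_univ_two]
    ring
  have hi : ∀ e f, IntervalIntegrable (fun t => (D.prop l (-t) * D.prop k t) e f) volume 0 T :=
    fun e f => (D.continuous_prop_mul_prop l k e f).intervalIntegrable _ _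
  have h := intervalIntegral.integral_eq_sub_of_hasDerivAt (a := 0) (b := T) (fun t _ => hd t)
    (Continuous.intervalIntegrable (by
      refine continuous_const.mul (Continuous.sub ?_ ?_)
      · exact continuous_finsetSum _ fun e _ =>
          (D.continuous_prop_mul_prop l k c e).mul continuous_const
      · exact continuous_finsetSum _ fun e _ =>
          continuous_const.mul (D.continuous_prop_mul_prop l k e d)) _ _)
  rw [neg_zero, prop_zero, prop_zero, one_mul, Matrix.one_apply] at h
  rw [← h, intervalIntegral.integral_const_mul, intervalIntegral.integral_sub,
    intervalIntegral.integral_finsetSum, intervalIntegral.integral_finsetSum]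
  · simp only [intervalIntegral.integral_mul_const, intervalIntegral.integral_const_mul, cross]
  · exact fun e _ => (hi e d).const_mul _
  · exact fun e _ => (hi c e).mul_const _
  · exact (continuous_finsetSum _ fun e _ =>
      (D.continuous_prop_mul_prop l k c e).mul continuous_const).intervalIntegrable _ _
  · exact (continuous_finsetSum _ fun e _ =>
      continuous_const.mul (D.continuous_prop_mul_prop l k e d)).intervalIntegrable _ _

end Dispersion

/-! ### The symbol of the coupled system and its lack of resonance -/

section KdVSymbol

/-- The symbol of the coupled system without its factor `k`. -/
noncomputable def reducedGap (α μ ζ η : ℝ) (k : ℤ) : ℂ :=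
  ⟨(((k : ℝ) ^ 2 - μ) - (α * (k : ℝ) ^ 2 - ζ)) / 2, -η⟩

noncomputable def reducedMean (α μ ζ : ℝ) (k : ℤ) : ℝ :=
  (((k : ℝ) ^ 2 - μ) + (α * (k : ℝ) ^ 2 - ζ)) / 2

theorem reducedGap_neg (α μ ζ η : ℝ) (k : ℤ) :
    reducedGap α μ ζ η (-k) = reducedGap α μ ζ η k := by
  simp [reducedGap]

theorem reducedMean_neg (α μ ζ : ℝ) (k : ℤ) : reducedMean α μ ζ (-k) = reducedMean α μ ζ k := by
  simp [reducedMean]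

/-- The sign attached to the two branches of eigenvalues. -/
def branchSign (σ : Fin 2) : ℝ := if σ = 0 then 1 else -1

noncomputable def kdvLam (α μ ζ η : ℝ) (k : ℤ) (σ : Fin 2) : ℝ :=
  k * (reducedMean α μ ζ k + branchSign σ * ‖reducedGap α μ ζ η k‖)

/-- A symmetric matrix with mean diagonal m, half difference p of the diagonal entries and
off-diagonal entry q equals m + r R(θ), where p + iq = r exp(iθ) and R(θ) has rows (cos θ, sin θ),
(sin θ, -cos θ). These are the spectral projections of R(θ); here p + iq is `reducedGap`. -/
noncomputable def branchProj (θ : ℝ) (σ : Fin 2) : Matrix (Fin 2) (Fin 2) ℝ :=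
  !![(1 + branchSign σ * Real.cos θ) / 2, branchSign σ * Real.sin θ / 2;
    branchSign σ * Real.sin θ / 2, (1 - branchSign σ * Real.cos θ) / 2]

noncomputable def kdvSymb (α μ ζ η : ℝ) (k : ℤ) : Matrix (Fin 2) (Fin 2) ℝ :=
  !![(k : ℝ) ^ 3 - μ * k, -(η * k); -(η * k), α * (k : ℝ) ^ 3 - ζ * k]

theorem abs_branchSign (σ : Fin 2) : |branchSign σ| = 1 := by
  unfold branchSign
  split_ifs <;> simp

theorem kdvLam_det (α μ ζ η : ℝ) (k : ℤ) (σ : Fin 2) :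
    ((k : ℝ) ^ 3 - μ * k - kdvLam α μ ζ η k σ) * (α * (k : ℝ) ^ 3 - ζ * k - kdvLam α μ ζ η k σ)
      = (η * k) ^ 2 := by
  have h1 : ‖reducedGap α μ ζ η k‖ ^ 2
      = ((((k : ℝ) ^ 2 - μ) - (α * (k : ℝ) ^ 2 - ζ)) / 2) ^ 2 + η ^ 2 := by
    rw [← Complex.normSq_eq_norm_sq, Complex.normSq_apply, reducedGap]
    ring
  have h2 : branchSign σ ^ 2 = 1 := by rw [← sq_abs, abs_branchSign, one_pow]
  unfold kdvLam reducedMean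
  linear_combination (k : ℝ) ^ 2 * branchSign σ ^ 2 * h1
    + (k : ℝ) ^ 2 * (((((k : ℝ) ^ 2 - μ) - (α * (k : ℝ) ^ 2 - ζ)) / 2) ^ 2 + η ^ 2) * h2

-- An eigenvalue r at frequency k makes det(M_k - r) vanish. As a polynomial in k this has degree 6
-- and leading coefficient α, so it has finitely many roots.
open Polynomial in
theorem finite_kdvLam {α : ℝ} (hα : α ≠ 0) (μ ζ η r : ℝ) :
    {k : ℤ | ∃ σ, kdvLam α μ ζ η k σ = r}.Finite := by
  let p : ℝ[X] := (X ^ 3 - C μ * X - C r) * (C α * X ^ 3 - C ζ * X - C r) - (C η * X) ^ 2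
  have hp : p ≠ 0 := by
    intro h0
    have h6 : p.coeff 6 = α := by
      have : p = C α * X ^ 6 + C (-ζ - μ * α) * X ^ 4 + C (-r - r * α) * X ^ 3
          + C (μ * ζ - η ^ 2) * X ^ 2 + C (μ * r + r * ζ) * X + C (r * r) := by
        simp only [p, map_sub, map_add, map_mul, map_neg, map_pow]
        ring
      rw [this]
      simp only [coeff_add, coeff_C_mul, coeff_X_pow, coeff_X, coeff_C]
      norm_num
    rw [h0, coeff_zero] at h6
    exact hα h6.symm
  refine Finite.subset ((p.roots.toFinset.finite_toSet).preimage
    (f := fun k : ℤ => (k : ℝ)) (Int.cast_injective.injOn)) ?_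
  rintro k ⟨σ, rfl⟩
  simp only [mem_preimage, Finset.mem_coe, Multiset.mem_toFinset, mem_roots hp, IsRoot.def]
  have := kdvLam_det α μ ζ η k σ
  simp only [p, eval_sub, eval_mul, eval_pow, eval_X, eval_C]
  linear_combination this

/-- The dispersive group of the coupled system. -/
noncomputable def kdvDispersion (α μ ζ η : ℝ) (hα : α ≠ 0) : Dispersion where
  symb := kdvSymb α μ ζ η
  lam := kdvLam α μ ζ η
  -- If the gap vanishes, `Complex.arg 0 = 0` selects the coordinate projections. They serve as
  -- well, since M_k is then scalar.
  proj k := branchProj (reducedGap α μ ζ η k).arg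
  lam_neg k σ := by
    simp only [kdvLam, reducedGap_neg, reducedMean_neg]
    push_cast
    ring
  proj_neg k σ := by rw [reducedGap_neg]
  proj_symm k σ c d := by
    fin_cases c <;> fin_cases d <;> simp [branchProj]
  proj_mul k σ σ' := by
    have h := Real.sin_sq_add_cos_sq (reducedGap α μ ζ η k).arg
    ext c d
    fin_cases σ <;> fin_cases σ' <;> fin_cases c <;> fin_cases d <;>
      simp [branchProj, branchSign, Matrix.mul_apply] <;>
      first | ring1 | linear_combination (1 / 4) * h | linear_combination (-1 / 4) * h
  proj_sum k := by
    ext c d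
    fin_cases c <;> fin_cases d <;> simp [branchProj, branchSign] <;> ring
  symb_eq k := by
    have h1 := Complex.norm_mul_cos_arg (reducedGap α μ ζ η k)
    have h2 := Complex.norm_mul_sin_arg (reducedGap α μ ζ η k)
    have h3 : (reducedGap α μ ζ η k).re
      = (((k : ℝ) ^ 2 - μ) - (α * (k : ℝ) ^ 2 - ζ)) / 2 := rfl
    have h4 : (reducedGap α μ ζ η k).im = -η := rfl
    rw [h3] at h1
    rw [h4] at h2
    ext c d
    fin_cases c <;> fin_cases d <;>
      simp [branchProj, branchSign, kdvSymb, kdvLam, reducedMean]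
    · linear_combination (-(k : ℝ)) * h1
    · linear_combination (-(k : ℝ)) * h2
    · linear_combination (-(k : ℝ)) * h2
    · linear_combination (k : ℝ) * h1
  abs_proj_le k σ c d := by
    have h1 := abs_le.mp (Real.abs_cos_le_one (reducedGap α μ ζ η k).arg)
    have h2 := abs_le.mp (Real.abs_sin_le_one (reducedGap α μ ζ η k).arg)
    rw [abs_le]
    fin_cases σ <;> fin_cases c <;> fin_cases d <;> simp [branchProj, branchSign] <;>
      constructor <;> linarith
  finite_lam := finite_kdvLam hα μ ζ η

/-- Equal branches give a difference of cubes, which factors with |x - y| ≥ 1. Distinct branches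
have coefficients of opposite sign because α < 0, so the two cubes add up. -/
theorem le_abs_leading_of_pos {α : ℝ} (hα : α < 0) {x y : ℝ} (hx : 1 ≤ x) (hy : 1 ≤ y)
    (hxy : 1 ≤ |x - y|) {a b : ℝ} (ha : a = 1 ∨ a = α) (hb : b = 1 ∨ b = α) :
    min 1 |α| * (x ^ 2 + y ^ 2) ≤ |a * x ^ 3 - b * y ^ 3| := by
  have hm1 : min 1 |α| ≤ 1 := min_le_left _ _
  have hm2 : min 1 |α| ≤ -α := by
    rw [← abs_of_neg hα]
    exact min_le_right _ _
  have hm0 : 0 ≤ min 1 |α| := by positivity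
  have hx2 : x ^ 2 ≤ x ^ 3 := pow_le_pow_right₀ hx (by norm_num)
  have hy2 : y ^ 2 ≤ y ^ 3 := pow_le_pow_right₀ hy (by norm_num)
  have hx0 : 0 ≤ x ^ 2 := by positivity
  have hy0 : 0 ≤ y ^ 2 := by positivity
  have hdiff : x ^ 2 + y ^ 2 ≤ |x ^ 3 - y ^ 3| := by
    have : x ^ 3 - y ^ 3 = (x - y) * (x ^ 2 + x * y + y ^ 2) := by ring
    have hq : 0 ≤ x ^ 2 + x * y + y ^ 2 := by nlinarith
    rw [this, abs_mul, abs_of_nonneg hq]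
    nlinarith
  have hmix : ∀ {p q : ℝ}, min 1 |α| ≤ p → min 1 |α| ≤ q →
      min 1 |α| * (x ^ 2 + y ^ 2) ≤ p * x ^ 3 + q * y ^ 3 := by
    intro p q hp hq
    rw [mul_add]
    exact add_le_add (mul_le_mul hp hx2 hx0 (hm0.trans hp)) (mul_le_mul hq hy2 hy0 (hm0.trans hq))
  rcases ha with rfl | rfl <;> rcases hb with rfl | rfl
  · rw [one_mul, one_mul]
    exact (mul_le_of_le_one_left (by positivity) hm1).trans hdiff
  · exact (hmix hm1 hm2).trans (le_of_eq_of_le (by ring) (le_abs_self _))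
  · exact (hmix hm2 hm1).trans (le_of_eq_of_le (by ring) (neg_le_abs _))
  · rw [← mul_sub, abs_mul]
    exact mul_le_mul (min_le_right _ _) hdiff (by positivity) (abs_nonneg _)

/-- Frequencies of the same sign reduce to positive ones, as the cubes are odd. -/
theorem le_abs_leading {α : ℝ} (hα : α < 0) {k l : ℤ} (hkl : 0 < k * l) (hne : l ≠ k)
    {a b : ℝ} (ha : a = 1 ∨ a = α) (hb : b = 1 ∨ b = α) :
    min 1 |α| * ((k : ℝ) ^ 2 + (l : ℝ) ^ 2) ≤ |a * (k : ℝ) ^ 3 - b * (l : ℝ) ^ 3| := by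
  have hd : 1 ≤ |(k : ℝ) - l| := by
    have : 1 ≤ |k - l| := Int.one_le_abs (sub_ne_zero.mpr hne.symm)
    exact_mod_cast this
  rcases mul_pos_iff.mp hkl with ⟨h1, h2⟩ | ⟨h1, h2⟩
  · exact le_abs_leading_of_pos hα (by exact_mod_cast h1) (by exact_mod_cast h2) hd ha hb
  · have := le_abs_leading_of_pos hα (x := -(k : ℝ)) (y := -(l : ℝ))
      (by exact_mod_cast (show 1 ≤ -k by omega)) (by exact_mod_cast (show 1 ≤ -l by omega))
      (by rwa [← abs_neg, neg_sub_neg, neg_sub]) ha hb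
    have e : a * (k : ℝ) ^ 3 - b * (l : ℝ) ^ 3
        = -(a * (-(k : ℝ)) ^ 3 - b * (-(l : ℝ)) ^ 3) := by ring
    rwa [e, abs_neg, ← neg_sq (k : ℝ), ← neg_sq (l : ℝ)]

/-- The diagonal part of the Sylvester equation, with the coupling on the other side. -/
theorem norm_leading_mul_cross_le {α : ℝ} (hα : α < 0) (μ ζ η : ℝ) {T : ℝ} (hT : 0 ≤ T)
    (l k : ℤ) (c d : Fin 2) :
    ‖((((if d = 0 then 1 else α) * (k : ℝ) ^ 3 - (if c = 0 then 1 else α) * (l : ℝ) ^ 3 : ℝ)) : ℂ)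
      * (kdvDispersion α μ ζ η hα.ne).cross T l k c d‖
      ≤ (9 + 8 * T * (|μ| + |ζ| + |η|)) * (1 + |(k : ℝ)| + |(l : ℝ)|) := by
  set D := kdvDispersion α μ ζ η hα.ne with hD
  have hX := D.norm_cross_le hT l k
  let m : Fin 2 → ℝ := fun e => if e = 0 then μ else ζ
  have hm : ∀ e, |m e| ≤ |μ| + |ζ| := by
    intro e
    simp only [m]
    split_ifs
    · linarith [abs_nonneg ζ]
    · linarith [abs_nonneg μ]
  have hsyl := D.cross_sylvester T l k c d
  have hsymb : ∀ j e f, D.symb j e f = kdvSymb α μ ζ η j e f := fun _ _ _ => rfl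
  have hY : ‖(D.prop l (-T) * D.prop k T) c d - (if c = d then 1 else 0)‖ ≤ 9 := by
    refine (norm_sub_le _ _).trans ?_
    have h1 := D.norm_prop_mul_prop_le l k (-T) T c d
    have h2 : ‖(if c = d then 1 else 0 : ℂ)‖ ≤ 1 := by split_ifs <;> simp
    linarith
  -- Only the diagonal cubic terms stay on the left. The lower order terms are O(|k| + |l|) because
  -- the cross integrals are bounded by 8T; `1 - c` and `1 - d` are the other component.
  have key : ((((if d = 0 then 1 else α) * (k : ℝ) ^ 3
        - (if c = 0 then 1 else α) * (l : ℝ) ^ 3 : ℝ)) : ℂ) * D.cross T l k c d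
      = -Complex.I * ((D.prop l (-T) * D.prop k T) c d - (if c = d then 1 else 0))
        + (m d * k) * D.cross T l k c d - (m c * l) * D.cross T l k c d
        + (η * k) * D.cross T l k c (1 - d) - (η * l) * D.cross T l k (1 - c) d := by
    rw [hsyl]
    simp only [hsymb, Fin.sum_univ_two, kdvSymb, m]
    fin_cases c <;> fin_cases d <;> simp <;> ring_nf <;> simp only [Complex.I_sq] <;> ring
  rw [key]
  have e1 : ‖-Complex.I * ((D.prop l (-T) * D.prop k T) c d - (if c = d then 1 else 0))‖ ≤ 9 := by
    rw [norm_mul, norm_neg, Complex.norm_I, one_mul]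
    exact hY
  have e2 : ∀ (r : ℝ) (j : ℤ) (x : ℂ) (R : ℝ), |r| ≤ R → ‖x‖ ≤ 8 * T →
      ‖((r : ℂ) * (j : ℂ)) * x‖ ≤ 8 * T * R * |(j : ℝ)| := by
    intro r j x R hr hx
    have hR : 0 ≤ R := (abs_nonneg r).trans hr
    have h3 : ‖(j : ℂ)‖ = |(j : ℝ)| := Complex.norm_intCast j
    rw [norm_mul, norm_mul, h3, Complex.norm_real, Real.norm_eq_abs]
    calc |r| * |(j : ℝ)| * ‖x‖ ≤ R * |(j : ℝ)| * (8 * T) := by gcongr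
      _ = _ := by ring
  have e3 := e2 (m d) k _ _ (hm d) (hX c d)
  have e4 := e2 (m c) l _ _ (hm c) (hX c d)
  have e5 := e2 η k _ _ le_rfl (hX c (1 - d))
  have e6 := e2 η l _ _ le_rfl (hX (1 - c) d)
  refine (norm_sub_le _ _).trans ?_
  refine (add_le_add (norm_add_le _ _) le_rfl).trans ?_
  refine (add_le_add (add_le_add (norm_sub_le _ _) le_rfl) le_rfl).trans ?_
  refine (add_le_add (add_le_add (add_le_add (norm_add_le _ _) le_rfl) le_rfl) le_rfl).trans ?_
  have h8 : 0 ≤ 8 * T * (|μ| + |ζ| + |η|) := by positivity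
  nlinarith [abs_nonneg (k : ℝ), abs_nonneg (l : ℝ)]

/-- Away from the diagonal the cross integrals gain one derivative. -/
theorem exists_norm_cross_kdv_le {α : ℝ} (hα : α < 0) (μ ζ η : ℝ) {T : ℝ} (hT : 0 ≤ T) :
    ∃ C : ℝ, 0 ≤ C ∧ ∀ l k c d, l ≠ k →
      ‖(kdvDispersion α μ ζ η hα.ne).cross T l k c d‖
        ≤ C * (1 + |((l - k : ℤ) : ℝ)|) / (1 + |(l : ℝ)|) := by
  set B := 9 + 8 * T * (|μ| + |ζ| + |η|) with hB
  set m := min 1 |α| with hm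
  have hm0 : 0 < m := lt_min one_pos (abs_pos.mpr hα.ne)
  have hB0 : 0 ≤ B := by positivity
  -- The first summand serves kl ≤ 0, by the trivial bound; the second serves kl > 0, where 6 comes
  -- from (1+p+q)(1+q) ≤ 6(p²+q²) for p, q ≥ 1.
  refine ⟨8 * T + 6 * B / m, by positivity, fun l k c d hne => ?_⟩
  set x := ‖(kdvDispersion α μ ζ η hα.ne).cross T l k c d‖ with hx
  have hx0 : 0 ≤ x := norm_nonneg _
  have hx8 : x ≤ 8 * T := Dispersion.norm_cross_le _ hT l k c d
  have hq : 0 ≤ 6 * B / m := by positivity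
  rw [le_div_iff₀ (by positivity)]
  rcases lt_or_ge 0 (k * l) with hkl | hkl
  · have h1 := norm_leading_mul_cross_le hα μ ζ η hT l k c d
    rw [norm_mul, Complex.norm_real, Real.norm_eq_abs, ← hx, ← hB] at h1
    have h2 := le_abs_leading hα hkl hne (a := if d = 0 then 1 else α)
      (b := if c = 0 then 1 else α) (by split_ifs <;> simp) (by split_ifs <;> simp)
    rw [← hm] at h2
    have hk : 1 ≤ |(k : ℝ)| := by
      exact_mod_cast Int.one_le_abs (left_ne_zero_of_mul hkl.ne')
    have hl : 1 ≤ |(l : ℝ)| := by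
      exact_mod_cast Int.one_le_abs (right_ne_zero_of_mul hkl.ne')
    have h3 : m * ((k : ℝ) ^ 2 + (l : ℝ) ^ 2) * x ≤ B * (1 + |(k : ℝ)| + |(l : ℝ)|) :=
      (mul_le_mul_of_nonneg_right h2 hx0).trans h1
    rw [← sq_abs (k : ℝ), ← sq_abs (l : ℝ)] at h3
    have hd : 0 ≤ |((l - k : ℤ) : ℝ)| := abs_nonneg _
    generalize |((l - k : ℤ) : ℝ)| = δ at *
    generalize |(k : ℝ)| = p at *
    generalize |(l : ℝ)| = q at *
    have h4 : (1 + p + q) * (1 + q) ≤ 6 * (p ^ 2 + q ^ 2) := by nlinarith [sq_nonneg (p - q)]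
    have h5 : x * (1 + q) * (m * (p ^ 2 + q ^ 2)) ≤ 6 * B * (p ^ 2 + q ^ 2) := by
      nlinarith [mul_le_mul_of_nonneg_right h3 (show 0 ≤ 1 + q by linarith),
        mul_le_mul_of_nonneg_left h4 hB0]
    have h6 : x * (1 + q) * m ≤ 6 * B := by
      refine le_of_mul_le_mul_right ?_ (show 0 < p ^ 2 + q ^ 2 by positivity)
      linarith
    have h7 : x * (1 + q) ≤ 6 * B / m := by rwa [le_div_iff₀ hm0]
    nlinarith
  -- Resonances are possible here, but k and l lie on opposite sides of zero, so 1 + |l| is absorbed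
  -- by 1 + |l - k|.
  · have h1 : |(l : ℝ)| ≤ |((l - k : ℤ) : ℝ)| := by
      have h2 : (k : ℝ) * l ≤ 0 := by exact_mod_cast hkl
      rw [← sq_le_sq]
      push_cast
      nlinarith [sq_nonneg (k : ℝ)]
    have h0 := abs_nonneg (l : ℝ)
    generalize |((l - k : ℤ) : ℝ)| = δ at *
    generalize |(l : ℝ)| = q at *
    nlinarith [mul_nonneg hx0 h0, mul_nonneg hq h0]

end KdVSymbol

/-- A frequency together with one of the two components of the system. -/
abbrev Mode : Type := ℤ × Fin 2

/-! ### The group and the Gramian on the sequence space -/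

section Weights

theorem summable_one_add_abs_sq : Summable fun k : ℤ => 1 / (1 + |(k : ℝ)|) ^ 2 := by
  have h : Summable fun n : ℕ => 1 / (1 + (n : ℝ)) ^ 2 := by
    have := (summable_nat_add_iff 1).mpr (Real.summable_one_div_nat_pow.mpr one_lt_two)
    simpa [add_comm] using this
  refine Summable.of_nat_of_neg ?_ ?_
  · simpa using h
  · simpa using h

/-- The profile `C / (1 + |k|) ^ 2` of band matrices. -/
noncomputable def bandWeight (C : ℝ) (i : Mode) : ℝ := C * (1 / (1 + |(i.1 : ℝ)|) ^ 2)

theorem summable_bandWeight (C : ℝ) : Summable (bandWeight C) := by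
  refine Summable.mul_left C ?_
  have h : Summable fun i : Mode => 1 / (1 + |(i.1 : ℝ)|) ^ 2 * (fun _ : Fin 2 => (1 : ℝ)) i.2 :=
    summable_one_add_abs_sq.mul_of_nonneg (g := fun _ : Fin 2 => (1 : ℝ))
      (Summable.of_finite) (fun _ => by positivity) (fun _ => zero_le_one)
  simpa using h

theorem tendsto_inv_one_add_abs_cofinite :
    Filter.Tendsto (fun i : Mode => ((1 / (1 + |(i.1 : ℝ)|) : ℝ) : ℂ)) Filter.cofinite (nhds 0) := by
  have h1 : Filter.Tendsto (fun i : Mode => i.1) Filter.cofinite Filter.cofinite := by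
    intro s hs
    rw [Filter.mem_cofinite] at hs
    rw [Filter.mem_map, Filter.mem_cofinite]
    refine (hs.prod (finite_univ (α := Fin 2))).subset ?_
    rintro ⟨k, c⟩ h
    exact ⟨h, mem_univ _⟩
  have h2 : Filter.Tendsto (fun k : ℤ => |(k : ℝ)|) Filter.cofinite Filter.atTop :=
    (tendsto_norm_cocompact_atTop (E := ℝ)).comp Int.tendsto_coe_cofinite
  have h3 : Filter.Tendsto (fun i : Mode => 1 / (1 + |(i.1 : ℝ)|)) Filter.cofinite (nhds 0) := by
    simp only [one_div]
    exact ((Filter.tendsto_atTop_add_const_left _ 1 (h2.comp h1))).inv_tendsto_atTop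
  have := (Complex.continuous_ofReal.tendsto 0).comp h3
  rwa [Complex.ofReal_zero] at this

end Weights

namespace Dispersion

variable (D : Dispersion)

/-- `Mode` is an additive group, so the block diagonal group counts as a band matrix; `bandWeight`
ignores the difference of the components. -/
theorem norm_group_entry_le (t : ℝ) (i j : Mode) :
    ‖(if i.1 = j.1 then D.prop i.1 t i.2 j.2 else 0 : ℂ)‖ ≤ bandWeight 2 (i - j) := by
  unfold bandWeight
  split_ifs with h
  · simpa [h] using D.norm_prop_le j.1 t i.2 j.2
  · rw [norm_zero]
    positivity

/-- The unitary group generated by the system, on weighted Fourier coefficients. -/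
noncomputable def group (t : ℝ) : EllTwo Mode →L[ℂ] EllTwo Mode :=
  bandCLM (fun i j => if i.1 = j.1 then D.prop i.1 t i.2 j.2 else 0) (bandWeight 2)
    (D.norm_group_entry_le t)

theorem group_apply (t : ℝ) (x : EllTwo Mode) (k : ℤ) (c : Fin 2) :
    D.group t x (k, c) = ∑ d, D.prop k t c d * x (k, d) := by
  have h1 := hasSum_bandCLM (summable_bandWeight 2) (D.norm_group_entry_le t) x (k, c)
  have h2 : HasSum (fun j : Mode => (if k = j.1 then D.prop k t c j.2 else 0) * x j)
      (∑ j ∈ ({k} : Finset ℤ) ×ˢ (Finset.univ : Finset (Fin 2)),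
        (if k = j.1 then D.prop k t c j.2 else 0) * x j) := by
    refine hasSum_sum_of_ne_finset_zero fun j hj => ?_
    rw [if_neg, zero_mul]
    rintro rfl
    exact hj (by simp)
  rw [Finset.sum_product, Finset.sum_singleton] at h2
  simp only [if_true] at h2
  exact h1.unique h2

/-- A uniform bound of the group. -/
noncomputable def groupBound : ℝ := ∑' i, bandWeight 2 i

theorem groupBound_nonneg : 0 ≤ groupBound :=
  tsum_nonneg fun i => by unfold bandWeight; positivity

theorem norm_group_le (t : ℝ) : ‖D.group t‖ ≤ groupBound :=
  norm_bandCLM_le (summable_bandWeight 2) _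

theorem group_group (s t : ℝ) (x : EllTwo Mode) :
    D.group s (D.group t x) = D.group (s + t) x := by
  ext ⟨k, c⟩
  simp only [group_apply]
  rw [← D.prop_mul]
  simp only [Matrix.mul_apply, Fin.sum_univ_two]
  ring

theorem group_zero (x : EllTwo Mode) : D.group 0 x = x := by
  ext ⟨k, c⟩
  rw [group_apply, prop_zero]
  simp [Matrix.one_apply]

theorem group_unitVec (t : ℝ) (j : Mode) :
    D.group t (unitVec j) = ∑ c, D.prop j.1 t c j.2 • unitVec (j.1, c) := by
  ext ⟨k, c⟩
  rw [group_apply, ← coordCLM_apply, map_sum]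
  simp only [map_smul, coordCLM_apply, unitVec_apply, smul_eq_mul, Prod.ext_iff]
  by_cases h : k = j.1
  · simp [h]
  · simp [h]

theorem inner_group (t : ℝ) (x y : EllTwo Mode) :
    inner ℂ (D.group t x) y = inner ℂ x (D.group (-t) y) := by
  refine inner_map_eq_of_entries (fun i j => ?_) x y
  have h : ∀ t (i j : Mode), D.group t (unitVec j) i
      = if i.1 = j.1 then D.prop i.1 t i.2 j.2 else 0 := fun t i j =>
    bandCLM_unitVec (summable_bandWeight 2) (D.norm_group_entry_le t) i j
  rw [h, h]
  by_cases hij : i.1 = j.1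
  · rw [if_pos hij, if_pos hij.symm, D.conj_prop_symm, neg_neg, hij]
  · rw [if_neg hij, if_neg (Ne.symm hij), map_zero]

/-- Continuity is strong only. The uniform bound on the group makes the orbit of x a uniform limit
of orbits of finitely supported vectors, which are continuous. -/
theorem continuous_group (x : EllTwo Mode) : Continuous fun t => D.group t x := by
  have hu : TendstoUniformly (fun (s : Finset Mode) t => D.group t (∑ i ∈ s, x i • unitVec i))
      (fun t => D.group t x) Filter.atTop := by
    rw [Metric.tendstoUniformly_iff]
    intro ε hε
    have h1 := (hasSum_unitVec x)
    have h2 := Metric.tendsto_nhds.mp h1 (ε / (groupBound + 1))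
      (by have := groupBound_nonneg; positivity)
    filter_upwards [h2] with s hs t
    rw [dist_eq_norm, ← map_sub]
    have h3 := (D.group t).le_opNorm (x - ∑ i ∈ s, x i • unitVec i)
    rw [dist_comm, dist_eq_norm, lt_div_iff₀ (by have := groupBound_nonneg; positivity)] at hs
    have h4 := mul_le_mul_of_nonneg_right (D.norm_group_le t)
      (norm_nonneg (x - ∑ i ∈ s, x i • unitVec i))
    nlinarith [norm_nonneg (x - ∑ i ∈ s, x i • unitVec i)]
  refine hu.continuous (Filter.Frequently.of_forall fun s => ?_)
  simp only [map_sum, map_smul, group_unitVec]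
  exact continuous_finsetSum _ fun i _ => (continuous_finsetSum _ fun c _ =>
    (D.continuous_prop i.1 c i.2).smul continuous_const).const_smul (x i)

theorem continuous_group_comp {f : ℝ → ℝ} {y : ℝ → EllTwo Mode} (hf : Continuous f)
    (hy : Continuous y) : Continuous fun t => D.group (f t) (y t) := by
  rw [continuous_iff_continuousAt]
  intro t₀
  have h1 : Filter.Tendsto (fun t => D.group (f t) (y t₀)) (nhds t₀) (nhds (D.group (f t₀) (y t₀))) :=
    ((D.continuous_group (y t₀)).comp hf).tendsto t₀
  have h2 : Filter.Tendsto (fun t => D.group (f t) (y t - y t₀)) (nhds t₀) (nhds 0) := by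
    refine squeeze_zero_norm (a := fun t => groupBound * ‖y t - y t₀‖) (fun t => ?_) ?_
    · exact (D.group (f t)).le_of_opNorm_le (D.norm_group_le _) _
    · have : Continuous fun t => groupBound * ‖y t - y t₀‖ := by fun_prop
      simpa using this.tendsto t₀
  have h3 := h1.add h2
  simpa [ContinuousAt] using h3

variable (G : EllTwo Mode →L[ℂ] EllTwo Mode)

theorem continuous_conjugate (x : EllTwo Mode) :
    Continuous fun t => D.group (-t) (G (D.group t x)) :=
  D.continuous_group_comp continuous_neg (G.continuous.comp (D.continuous_group x))

/-- The controllability Gramian `∫₀ᵀ S(-t) G S(t) dt`. -/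
noncomputable def gram (T : ℝ) : EllTwo Mode →L[ℂ] EllTwo Mode :=
  LinearMap.mkContinuous
    { toFun := fun x => ∫ t in (0 : ℝ)..T, D.group (-t) (G (D.group t x))
      map_add' := fun x y => by
        simp only [map_add]
        exact intervalIntegral.integral_add ((D.continuous_conjugate G x).intervalIntegrable _ _)
          ((D.continuous_conjugate G y).intervalIntegrable _ _)
      map_smul' := fun c x => by
        simp only [map_smul]
        exact intervalIntegral.integral_smul c _ }
    (groupBound * ‖G‖ * groupBound * |T - 0|) fun x => by
      have h : ∀ t ∈ Set.uIoc 0 T, ‖D.group (-t) (G (D.group t x))‖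
          ≤ groupBound * ‖G‖ * groupBound * ‖x‖ := by
        intro t _
        have h0 := groupBound_nonneg
        calc _ ≤ groupBound * ‖G (D.group t x)‖ :=
              (D.group (-t)).le_of_opNorm_le (D.norm_group_le _) _
          _ ≤ groupBound * (‖G‖ * (groupBound * ‖x‖)) := by
              gcongr
              exact G.le_opNorm_of_le ((D.group t).le_of_opNorm_le (D.norm_group_le _) _)
          _ = _ := by ring
      refine (intervalIntegral.norm_integral_le_of_norm_le_const h).trans (le_of_eq ?_)
      ring

theorem gram_apply (T : ℝ) (x : EllTwo Mode) :
    D.gram G T x = ∫ t in (0 : ℝ)..T, D.group (-t) (G (D.group t x)) := rfl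

/-- `G` acts on both components by the frequency matrix `γ`. -/
def _root_.CoupledKdV.HasFreqMatrix (G : EllTwo Mode →L[ℂ] EllTwo Mode) (γ : ℤ → ℤ → ℂ) : Prop :=
  ∀ i j : Mode, G (unitVec j) i = if i.2 = j.2 then γ i.1 j.1 else 0

variable {G} {γ : ℤ → ℤ → ℂ}

/-- G acts on each component by the same scalar γ(l,k), which can be pulled out between the two
propagators and out of the time integral. -/
theorem gram_unitVec (hG : HasFreqMatrix G γ) (T : ℝ) (i j : Mode) :
    D.gram G T (unitVec j) i = γ i.1 j.1 * D.cross T i.1 j.1 i.2 j.2 := by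
  rw [← coordCLM_apply, gram_apply, ← ContinuousLinearMap.intervalIntegral_comp_comm _
    ((D.continuous_conjugate G _).intervalIntegrable _ _), cross,
    ← intervalIntegral.integral_const_mul]
  refine intervalIntegral.integral_congr fun t _ => ?_
  have h : ∀ c, G (D.group t (unitVec j)) (i.1, c) = γ i.1 j.1 * D.prop j.1 t c j.2 := by
    intro c
    rw [group_unitVec, map_sum, ← coordCLM_apply, map_sum]
    simp only [map_smul, coordCLM_apply, hG _ _, smul_eq_mul, mul_ite, mul_zero]
    rw [Finset.sum_ite_eq]
    simp [mul_comm]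
  change D.group (-t) (G (D.group t (unitVec j))) (i.1, i.2) = _
  rw [group_apply, Matrix.mul_apply, Finset.mul_sum]
  refine Finset.sum_congr rfl fun c _ => ?_
  rw [h]
  ring

/-- The Gramian is a compact perturbation of a multiple of the identity. -/
theorem exists_compact_gram (hG : HasFreqMatrix G γ) {T : ℝ} {c₀ : ℂ} {C₁ C₂ C₃ : ℝ} (hT : 0 ≤ T)
    (hC₁ : 0 ≤ C₁) (hC₂ : 0 ≤ C₂) (hC₃ : 0 ≤ C₃)
    (hγ : ∀ l k, ‖γ l k‖ ≤ C₁ / (1 + |((l - k : ℤ) : ℝ)|) ^ 3)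
    (hdiag : ∀ k, ‖γ k k - c₀‖ ≤ C₂ / (1 + |(k : ℝ)|))
    (hcross : ∀ l k c d, l ≠ k →
      ‖D.cross T l k c d‖ ≤ C₃ * (1 + |((l - k : ℤ) : ℝ)|) / (1 + |(l : ℝ)|)) :
    ∃ K : EllTwo Mode →L[ℂ] EllTwo Mode, IsCompactOperator K ∧
      D.gram G T = (T * c₀) • ContinuousLinearMap.id ℂ (EllTwo Mode) + K := by
  -- The remainder multiplied by 1 + |l| is still a band matrix, so the remainder is a bounded
  -- operator followed by the compact diagonal operator with entries 1/(1 + |l|).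
  let b : Mode → Mode → ℂ := fun i j => ((1 + |(i.1 : ℝ)| : ℝ) : ℂ) *
    (γ i.1 j.1 * D.cross T i.1 j.1 i.2 j.2 - if i = j then T * c₀ else 0)
  have hb : ∀ i j, ‖b i j‖ ≤ bandWeight (C₁ * C₃ + T * C₂) (i - j) := by
    rintro ⟨l, c⟩ ⟨k, d⟩
    have hpos : 0 < 1 + |(l : ℝ)| := by positivity
    simp only [b, norm_mul, Complex.norm_real, Real.norm_eq_abs, abs_of_pos hpos, bandWeight,
      Prod.mk_sub_mk, Prod.mk.injEq]
    by_cases hlk : l = k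
    · subst hlk
      simp only [cross_self, true_and, sub_self, Int.cast_zero, abs_zero, add_zero, one_pow,
        div_one, mul_one]
      split_ifs with hcd
      · have h1 := hdiag l
        rw [le_div_iff₀ hpos] at h1
        have h2 : γ l l * (T : ℂ) - T * c₀ = T * (γ l l - c₀) := by ring
        rw [h2, norm_mul, Complex.norm_real, Real.norm_of_nonneg hT]
        have h3 : 0 ≤ C₁ * C₃ := by positivity
        nlinarith
      · simp
        positivity
    · rw [if_neg (fun h => hlk h.1), sub_zero, norm_mul]
      have h1 := hγ l k
      have h2 := hcross l k c d hlk
      have hδ : 0 < 1 + |((l - k : ℤ) : ℝ)| := by positivity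
      -- Of the three powers of decay of γ, one pays for the growth of the cross integral in l - k
      -- and two remain for summability.
      calc (1 + |(l : ℝ)|) * (‖γ l k‖ * ‖D.cross T l k c d‖)
          ≤ (1 + |(l : ℝ)|) * ((C₁ / (1 + |((l - k : ℤ) : ℝ)|) ^ 3)
            * (C₃ * (1 + |((l - k : ℤ) : ℝ)|) / (1 + |(l : ℝ)|))) := by gcongr
        _ = C₁ * C₃ * (1 / (1 + |((l - k : ℤ) : ℝ)|) ^ 2) := by
            field_simp
        _ ≤ _ := by
            gcongr
            exact le_add_of_nonneg_right (by positivity)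
  have hle : ∀ i : Mode, ‖((1 / (1 + |(i.1 : ℝ)|) : ℝ) : ℂ)‖ ≤ 1 := by
    intro i
    rw [Complex.norm_real, Real.norm_of_nonneg (by positivity), div_le_one (by positivity)]
    linarith [abs_nonneg (i.1 : ℝ)]
  let W := weightedComp id Function.injective_id
    (fun i : Mode => ((1 / (1 + |(i.1 : ℝ)|) : ℝ) : ℂ)) 1 zero_le_one hle
  let B := bandCLM b (bandWeight (C₁ * C₃ + T * C₂)) hb
  refine ⟨W.comp B, ?_, clm_ext_unitVec fun j => ?_⟩
  · exact (isCompactOperator_diagonal zero_le_one hle tendsto_inv_one_add_abs_cofinite).comp_clm B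
  · ext i
    have h1 : (W.comp B) (unitVec j) i = ((1 / (1 + |(i.1 : ℝ)|) : ℝ) : ℂ) * b i j := by
      have h2 : B (unitVec j) i = b i j := bandCLM_unitVec (summable_bandWeight _) hb i j
      rw [← h2]
      rfl
    change _ = (T * c₀) * unitVec j i + (W.comp B) (unitVec j) i
    rw [h1, gram_unitVec D hG, unitVec_apply]
    have hpos : ((1 + |(i.1 : ℝ)| : ℝ) : ℂ) ≠ 0 := by
      exact_mod_cast (show (0 : ℝ) < 1 + |(i.1 : ℝ)| by positivity).ne'
    simp only [b]
    rw [Complex.ofReal_div, Complex.ofReal_one, ← mul_assoc, one_div, inv_mul_cancel₀ hpos, one_mul]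
    split_ifs <;> ring

end Dispersion

/-! ### Unique continuation -/

section Positive

variable {E : Type*} [NormedAddCommGroup E] [InnerProductSpace ℂ E]

/-- A symmetric nonnegative operator vanishes where its quadratic form vanishes. -/
theorem map_eq_zero_of_re_inner_eq_zero {G : E →L[ℂ] E}
    (hsymm : ∀ x y, inner ℂ (G x) y = inner ℂ x (G y)) (hpos : ∀ x, 0 ≤ (inner ℂ x (G x)).re)
    {x : E} (hx : (inner ℂ x (G x)).re = 0) : G x = 0 := by
  by_contra hne
  set b := ‖G x‖ ^ 2 with hb
  have hb0 : 0 < b := by positivity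
  set a := (inner ℂ (G x) (G (G x))).re with ha
  -- The nonnegative form evaluated at x + tGx. The term linear in t must vanish, so Gx = 0.
  have key : ∀ t : ℝ, 0 ≤ 2 * t * b + t ^ 2 * a := by
    intro t
    have h := hpos (x + (t : ℂ) • G x)
    have h1 : (inner ℂ (G x) (G x)).re = b := by
      rw [inner_self_eq_norm_sq_to_K]
      norm_cast
    have h2 : (inner ℂ x (G (G x))).re = b := by rw [← hsymm, h1]
    simp only [map_add, map_smul, inner_add_left, inner_add_right, inner_smul_left,
      inner_smul_right, Complex.conj_ofReal, Complex.add_re, Complex.re_ofReal_mul, hx, h1, h2,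
      ← ha] at h
    nlinarith
  have ha0 : 0 ≤ a := hpos _
  -- The shift by 1 avoids dividing by a, which may vanish.
  have h := key (-(b / (a + 1)))
  have h1 : b / (a + 1) * (a + 1) = b := by field_simp
  have h2 : 0 < b / (a + 1) := by positivity
  nlinarith

end Positive

namespace Dispersion

variable (D : Dispersion) {G : EllTwo Mode →L[ℂ] EllTwo Mode}

/-- By unitarity ⟨x, Λ_T x⟩ is the time integral of the nonnegative continuous function ⟨S(t)x, G
S(t)x⟩, which must therefore vanish identically. -/
theorem map_group_eq_zero_of_gram_eq_zero
    (hsymm : ∀ x y, inner ℂ (G x) y = inner ℂ x (G y)) (hpos : ∀ x, 0 ≤ (inner ℂ x (G x)).re)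
    {T : ℝ} (hT : 0 < T) {x : EllTwo Mode} (hx : D.gram G T x = 0) {t : ℝ} (ht : t ∈ Icc 0 T) :
    G (D.group t x) = 0 := by
  refine map_eq_zero_of_re_inner_eq_zero hsymm hpos ?_
  by_contra hne
  have hlt : 0 < (inner ℂ (D.group t x) (G (D.group t x))).re :=
    lt_of_le_of_ne (hpos _) (Ne.symm hne)
  have heq : ∀ t, (inner ℂ x (D.group (-t) (G (D.group t x)))).re
      = (inner ℂ (D.group t x) (G (D.group t x))).re := fun t => by rw [inner_group]
  have hcont : Continuous fun t => (inner ℂ (D.group t x) (G (D.group t x))).re :=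
    Complex.continuous_re.comp
      ((D.continuous_group x).inner (G.continuous.comp (D.continuous_group x)))
  have hint := intervalIntegral.integral_pos hT hcont.continuousOn (fun t _ => hpos _) ⟨t, ht, hlt⟩
  have h0 : ∫ t in (0 : ℝ)..T, (inner ℂ (D.group t x) (G (D.group t x))).re
      = (inner ℂ x (D.gram G T x)).re := by
    have h1 := (Complex.reCLM.comp ((innerSL ℂ x).restrictScalars ℝ)).intervalIntegral_comp_comm
      ((D.continuous_conjugate G x).intervalIntegrable (μ := volume) 0 T)
    rw [gram_apply]
    refine Eq.trans ?_ h1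
    exact intervalIntegral.integral_congr fun t _ => (heq t).symm
  rw [h0, hx, inner_zero_right] at hint
  exact lt_irrefl _ hint

/-- A time step at which the exponentials of distinct eigenvalues stay distinct. -/
theorem exists_generic_step {δ : ℝ} (hδ : 0 < δ) : ∃ ε ∈ Ioo 0 δ, ∀ i j : Mode,
    Complex.exp (D.lam i.1 i.2 * ε * Complex.I) = Complex.exp (D.lam j.1 j.2 * ε * Complex.I) →
      D.lam i.1 i.2 = D.lam j.1 j.2 := by
  -- A bad step satisfies (λ - λ')ε ∈ 2πℤ for some λ ≠ λ'. There are countably many such steps, and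
  -- the interval is uncountable.
  let bad : Set ℝ := ⋃ p : (Mode × Mode) × ℤ,
    {2 * π * p.2 / (D.lam p.1.1.1 p.1.1.2 - D.lam p.1.2.1 p.1.2.2)}
  have hbad : bad.Countable := countable_iUnion fun _ => countable_singleton _
  have hne : ¬ (Ioo 0 δ ⊆ bad) := fun h =>
    Cardinal.Real.Ioo_countable_iff.mp (hbad.mono h) |>.not_gt hδ
  obtain ⟨ε, hε, hεb⟩ := not_subset.mp hne
  refine ⟨ε, hε, fun i j hij => ?_⟩
  by_contra hlam
  obtain ⟨n, hn⟩ := Complex.exp_eq_exp_iff_exists_int.mp hij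
  refine hεb (mem_iUnion.mpr ⟨((i, j), n), ?_⟩)
  rw [mem_singleton_iff, eq_div_iff (sub_ne_zero.mpr hlam)]
  have h1 : (((D.lam i.1 i.2 - D.lam j.1 j.2) * ε : ℝ) : ℂ) * Complex.I
      = ((2 * π * n : ℝ) : ℂ) * Complex.I := by
    push_cast
    linear_combination hn
  have h2 := mul_right_cancel₀ Complex.I_ne_zero h1
  have h3 : (D.lam i.1 i.2 - D.lam j.1 j.2) * ε = 2 * π * n := by exact_mod_cast h2
  linarith

open Polynomial in
/-- An element whose orbit over a short time stays in a finite dimensional space has only finitely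
many active frequencies. -/
theorem finite_support_of_orbit {δ : ℝ} (hδ : 0 < δ) (V : Submodule ℂ (EllTwo Mode))
    [FiniteDimensional ℂ V] {x : EllTwo Mode} (hx : ∀ t ∈ Icc 0 δ, D.group t x ∈ V) :
    {i | x i ≠ 0}.Finite := by
  -- One more sample of the orbit than the dimension of V forces a linear relation; steps shorter
  -- than δ/n keep the samples inside [0, δ].
  set n := Module.finrank ℂ V + 1 with hn
  have hn0 : (0 : ℝ) < n := by rw [hn]; positivity
  obtain ⟨ε, hε, hgen⟩ := D.exists_generic_step (δ := δ / n) (by positivity)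
  let f : Fin n → V := fun m => ⟨D.group (m * ε) x, hx _ (by
    have h1 := hε.2.le
    rw [le_div_iff₀ hn0] at h1
    have h2 : ((m : ℕ) : ℝ) ≤ n := by exact_mod_cast m.2.le
    constructor
    · have := hε.1.le
      positivity
    · nlinarith [hε.1])⟩
  have hdep : ¬ LinearIndependent ℂ f := by
    intro h
    have := h.fintype_card_le_finrank
    simp [hn] at this
  obtain ⟨a, ha, m₀, hm₀⟩ := Fintype.not_linearIndependent_iff.mp hdep
  let p : ℂ[X] := ∑ m, C (a m) * X ^ (m : ℕ)
  have hp : p ≠ 0 := by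
    intro h0
    refine hm₀ ?_
    have h1 : p.coeff (m₀ : ℕ) = a m₀ := by
      simp only [p, finsetSum_coeff, coeff_C_mul, coeff_X_pow, Fin.val_inj]
      simp
    rw [← h1, h0, coeff_zero]
  have hsum : ∑ m : Fin n, a m • D.group (m * ε) x = 0 := by
    have := congrArg (Subtype.val) ha
    simpa [f] using this
  -- Projecting the relation onto an eigenspace gives p(exp(iλε)) P_σ x_k = 0. If neither branch
  -- gave a root of p, both projections of x_k would vanish.
  have hroot : ∀ k c, x (k, c) ≠ 0 → ∃ σ, p.IsRoot (Complex.exp (D.lam k σ * ε * Complex.I)) := by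
    intro k c hkc
    by_contra! hno
    have hproj : ∀ σ c, ∑ d, (D.proj k σ c d : ℂ) * x (k, d) = 0 := by
      intro σ c
      have h1 : p.eval (Complex.exp (D.lam k σ * ε * Complex.I))
          * ∑ d, (D.proj k σ c d : ℂ) * x (k, d) = 0 := by
        have h2 : ∀ m : Fin n, ∑ d, (D.proj k σ c d : ℂ) * D.group (m * ε) x (k, d)
            = Complex.exp (D.lam k σ * ε * Complex.I) ^ (m : ℕ)
              * ∑ d, (D.proj k σ c d : ℂ) * x (k, d) := by
          intro m
          have h3 := fun d => congrFun (congrFun (D.map_proj_mul_prop k (m * ε) σ) c) d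
          simp only [Matrix.mul_apply, Matrix.smul_apply, Matrix.map_apply, smul_eq_mul] at h3
          rw [← Complex.exp_nat_mul, Finset.mul_sum]
          have h4 : ((m : ℕ) : ℂ) * (D.lam k σ * ε * Complex.I)
              = D.lam k σ * ((m * ε : ℝ) : ℂ) * Complex.I := by
            push_cast
            ring
          simp only [h4, ← mul_assoc, ← h3, group_apply, Fin.sum_univ_two]
          ring
        have h5 : ∑ d, (D.proj k σ c d : ℂ) * (∑ m : Fin n, a m • D.group (m * ε) x) (k, d) = 0 := by
          rw [hsum]
          simp
        have h6 : ∀ d, (∑ m : Fin n, a m • D.group (m * ε) x) (k, d)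
            = ∑ m : Fin n, a m * D.group (m * ε) x (k, d) := by
          intro d
          rw [← coordCLM_apply, map_sum]
          rfl
        simp only [h6, Finset.mul_sum] at h5
        rw [Finset.sum_comm] at h5
        rw [← h5]
        simp only [p, eval_finsetSum, eval_mul, eval_C, eval_pow, eval_X]
        rw [Finset.sum_mul]
        refine Finset.sum_congr rfl fun m _ => ?_
        rw [mul_assoc, ← h2, Finset.mul_sum]
        refine Finset.sum_congr rfl fun d _ => ?_
        ring
      exact (mul_eq_zero.mp h1).resolve_left (hno σ)
    refine hkc ?_
    have h7 := congrFun (D.sum_map_proj k) c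
    have h8 : x (k, c) = ∑ σ, ∑ d, (D.proj k σ c d : ℂ) * x (k, d) := by
      have h9 : ∀ d, ∑ σ, (D.proj k σ c d : ℂ) = if c = d then 1 else 0 := by
        intro d
        have := congrFun h7 d
        rw [Matrix.sum_apply, Matrix.one_apply] at this
        exact this
      rw [Finset.sum_comm]
      simp only [← Finset.sum_mul, h9]
      simp
    rw [h8]
    simp [hproj]
  -- The roots of p determine the eigenvalues because ε is generic, and each eigenvalue occurs at
  -- finitely many frequencies.
  have hlam : {r | ∃ i : Mode, D.lam i.1 i.2 = r ∧
      p.IsRoot (Complex.exp (D.lam i.1 i.2 * ε * Complex.I))}.Finite := by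
    refine Finite.of_finite_image (f := fun r : ℝ => Complex.exp (r * ε * Complex.I))
      (p.roots.toFinset.finite_toSet.subset ?_) ?_
    · rintro _ ⟨r, ⟨i, rfl, hi⟩, rfl⟩
      simpa [mem_roots hp] using hi
    · rintro _ ⟨i, rfl, _⟩ _ ⟨j, rfl, _⟩ hij
      exact hgen i j hij
  refine (((hlam.biUnion fun r _ => D.finite_lam r)).prod (finite_univ (α := Fin 2))).subset ?_
  rintro ⟨k, c⟩ hkc
  obtain ⟨σ, hσ⟩ := hroot k c hkc
  refine ⟨?_, mem_univ _⟩
  rw [mem_iUnion₂]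
  exact ⟨D.lam k σ, ⟨(k, σ), rfl, hσ⟩, σ, rfl⟩

/-- Unique continuation: the Gramian is injective. -/
theorem gram_injective
    (hsymm : ∀ x y, inner ℂ (G x) y = inner ℂ x (G y)) (hpos : ∀ x, 0 ≤ (inner ℂ x (G x)).re)
    (hfin : ∀ x : EllTwo Mode, {i | x i ≠ 0}.Finite → G x = 0 → x = 0)
    (hker : ∀ T, 0 < T → FiniteDimensional ℂ (LinearMap.ker (D.gram G T : EllTwo Mode →ₗ[ℂ] EllTwo Mode)))
    {T : ℝ} (hT : 0 < T) {x : EllTwo Mode} (hx : D.gram G T x = 0) : x = 0 := by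
  have h0 : ∀ t ∈ Icc 0 T, G (D.group t x) = 0 := fun t ht =>
    D.map_group_eq_zero_of_gram_eq_zero hsymm hpos hT hx ht
  -- Half of the time is spent moving along the orbit and half inside the Gramian, so that r + t
  -- stays in [0, T].
  have := hker (T / 2) (by positivity)
  refine hfin x (D.finite_support_of_orbit (δ := T / 2) (by positivity)
    (LinearMap.ker (D.gram G (T / 2) : EllTwo Mode →ₗ[ℂ] EllTwo Mode)) fun t ht => ?_) ?_
  · change D.gram G (T / 2) (D.group t x) = 0
    rw [gram_apply, intervalIntegral.integral_congr (g := fun _ => (0 : EllTwo Mode)),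
      intervalIntegral.integral_zero]
    intro r hr
    rw [uIcc_of_le (by positivity)] at hr
    simp only
    rw [group_group D r t, h0 _ ⟨by linarith [hr.1, ht.1], by linarith [hr.2, ht.2]⟩, map_zero]
  · have := h0 0 ⟨le_rfl, hT.le⟩
    rwa [group_zero] at this

/-- Intertwined operators have intertwined Gramians. -/
theorem intertwine_gram {G' W : EllTwo Mode →L[ℂ] EllTwo Mode} (hG : ∀ x, W (G' x) = G (W x))
    (hW : ∀ t x, W (D.group t x) = D.group t (W x)) (T : ℝ) (x : EllTwo Mode) :
    W (D.gram G' T x) = D.gram G T (W x) := by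
  rw [gram_apply, gram_apply, ← W.intervalIntegral_comp_comm
    ((D.continuous_conjugate G' x).intervalIntegrable _ _)]
  simp only [hW, hG]

end Dispersion

/-- The normalised Haar measure of the torus. -/
local notation "haar" => (AddCircle.haarAddCircle : Measure Torus)

/-! ### Fourier coefficients of smooth functions, Parseval and convolution -/

section SmoothCoefficients

/-- The Fourier coefficients of a real-valued function. -/
noncomputable def realCoeff (φ : Torus → ℝ) (k : ℤ) : ℂ :=
  fourierCoeff (fun x : Torus => ((φ x : ℝ) : ℂ)) k

theorem IsSmooth.continuous {φ : Torus → ℝ} (hφ : IsSmooth φ) : Continuous φ := by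
  have h : Continuous fun x : ℝ => φ (x : Torus) := ContDiff.continuous hφ
  exact (QuotientAddGroup.isQuotientMap_mk (AddSubgroup.zmultiples (2 * π))).continuous_iff.mpr h

theorem IsSmooth.dx {φ : Torus → ℝ} (hφ : IsSmooth φ) : IsSmooth (dx φ) := by
  have h : (fun x : ℝ => CoupledKdV.dx φ (x : Torus)) = deriv fun x : ℝ => φ (x : Torus) := by
    ext y
    exact dx_coe φ y
  rw [IsSmooth, h]
  exact (contDiff_infty_iff_deriv.mp hφ).2

theorem realCoeff_dx {φ : Torus → ℝ} (hφ : IsSmooth φ) (k : ℤ) :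
    realCoeff (dx φ) k = Complex.I * k * realCoeff φ k := by
  have hd : ∀ y : ℝ, HasDerivAt (fun x : ℝ => ((φ (x : Torus) : ℝ) : ℂ))
      ((dx φ (y : Torus) : ℝ) : ℂ) y := by
    intro y
    rw [dx_coe]
    exact ((contDiff_infty_iff_deriv.mp hφ).1 y).hasDerivAt.ofReal_comp
  have he : ∀ y : ℝ, HasDerivAt (fun x : ℝ => (fourier (-k) (x : Torus) : ℂ))
      (-(Complex.I * k) * fourier (-k) (y : Torus)) y := by
    intro y
    refine (hasDerivAt_fourier_neg (2 * π) k y).congr_deriv ?_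
    have : (π : ℂ) ≠ 0 := by exact_mod_cast Real.pi_ne_zero
    push_cast
    field_simp
  have hprod := fun y => (he y).mul (hd y)
  have hc1 : Continuous fun x : ℝ => (fourier (-k) (x : Torus) : ℂ) :=
    (fourier (-k)).continuous.comp (AddCircle.continuous_mk' _)
  have hc2 : Continuous fun x : ℝ => ((φ (x : Torus) : ℝ) : ℂ) :=
    Complex.continuous_ofReal.comp (ContDiff.continuous hφ)
  have hc3 : Continuous fun x : ℝ => ((dx φ (x : Torus) : ℝ) : ℂ) :=
    Complex.continuous_ofReal.comp (ContDiff.continuous hφ.dx)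
  have h := intervalIntegral.integral_eq_sub_of_hasDerivAt (a := 0) (b := 0 + 2 * π)
    (fun y _ => hprod y) (Continuous.intervalIntegrable (by fun_prop) _ _)
  have hper : ((0 + 2 * π : ℝ) : Torus) = ((0 : ℝ) : Torus) := by
    rw [zero_add, AddCircle.coe_period]
    rfl
  simp only [Pi.mul_apply] at h
  rw [hper, sub_self, intervalIntegral.integral_add
    (Continuous.intervalIntegrable (by fun_prop) _ _)
    (Continuous.intervalIntegrable (by fun_prop) _ _)] at h
  simp only [mul_assoc, intervalIntegral.integral_const_mul] at h
  rw [realCoeff, realCoeff, fourierCoeff_eq_intervalIntegral _ k 0,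
    fourierCoeff_eq_intervalIntegral _ k 0]
  simp only [smul_eq_mul, Complex.real_smul]
  linear_combination (((1 / (2 * π) : ℝ)) : ℂ) * h

theorem norm_fourierCoeff_le {f : Torus → ℂ} {C : ℝ} (hf : ∀ x, ‖f x‖ ≤ C) (k : ℤ) :
    ‖fourierCoeff f k‖ ≤ C := by
  have h := norm_integral_le_of_norm_le_const (μ := haar)
    (f := fun x => fourier (-k) x • f x) (C := C) (Filter.Eventually.of_forall fun x => by
      rw [norm_smul, fourier_apply, Circle.norm_coe, one_mul]
      exact hf x)
  simpa [fourierCoeff] using h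

/-- Fourier coefficients of smooth functions decay rapidly. -/
theorem exists_realCoeff_decay (N : ℕ) : ∀ {φ : Torus → ℝ}, IsSmooth φ →
    ∃ C : ℝ, 0 ≤ C ∧ ∀ k : ℤ, ‖realCoeff φ k‖ ≤ C / (1 + |(k : ℝ)|) ^ N := by
  induction N with
  | zero =>
    intro φ hφ
    obtain ⟨C, hC⟩ := isCompact_univ.exists_bound_of_continuousOn hφ.continuous.continuousOn
    refine ⟨C, (norm_nonneg _).trans (hC 0 (mem_univ _)), fun k => ?_⟩
    rw [pow_zero, div_one]
    exact norm_fourierCoeff_le (fun x => by simpa using hC x (mem_univ _)) k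
  | succ N ih =>
    intro φ hφ
    obtain ⟨C, hC0, hC⟩ := ih hφ
    obtain ⟨C', hC0', hC'⟩ := ih hφ.dx
    refine ⟨C + C', by positivity, fun k => ?_⟩
    have h1 := hC k
    have h2 := hC' k
    rw [realCoeff_dx hφ, norm_mul, norm_mul, Complex.norm_I, one_mul, Complex.norm_intCast] at h2
    rw [le_div_iff₀ (by positivity)] at h1 h2 ⊢
    -- One more power costs one derivative: (1 + |k|)|φ̂(k)| is the sum of the moduli of the
    -- coefficients of φ and φ'.
    calc _ = ‖realCoeff φ k‖ * (1 + |(k : ℝ)|) ^ N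
          + |(k : ℝ)| * ‖realCoeff φ k‖ * (1 + |(k : ℝ)|) ^ N := by ring
      _ ≤ _ := add_le_add h1 h2

theorem fourierCoeff_conj (f : Torus → ℂ) (k : ℤ) :
    fourierCoeff (fun x => starRingEnd ℂ (f x)) k = starRingEnd ℂ (fourierCoeff f (-k)) := by
  rw [fourierCoeff, fourierCoeff, ← integral_conj]
  refine integral_congr_ae (Filter.Eventually.of_forall fun x => ?_)
  simp

theorem conj_realCoeff (φ : Torus → ℝ) (k : ℤ) :
    starRingEnd ℂ (realCoeff φ k) = realCoeff φ (-k) := by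
  have h := fourierCoeff_conj (fun x => ((φ x : ℝ) : ℂ)) (-k)
  simp only [Complex.conj_ofReal, neg_neg] at h
  exact h.symm

end SmoothCoefficients

section Parseval

theorem hasSum_fourierCoeff_mul {a b : Torus → ℂ} (ha : MemLp a 2 haar) (hb : MemLp b 2 haar) :
    HasSum (fun k => fourierCoeff a (-k) * fourierCoeff b k) (∫ x, a x * b x ∂haar) := by
  have ha' : MemLp (fun x => starRingEnd ℂ (a x)) 2 haar := ha.star
  have h := (fourierBasis (T := 2 * π)).hasSum_inner_mul_inner (ha'.toLp _) (hb.toLp _)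
  have hcoef : ∀ {f : Torus → ℂ} (hf : MemLp f 2 haar) k,
      inner ℂ (fourierBasis (T := 2 * π) k) (hf.toLp f) = fourierCoeff f k := by
    intro f hf k
    rw [← HilbertBasis.repr_apply_apply, fourierBasis_repr,
      fourierCoeff_congr_ae (MemLp.coeFn_toLp hf)]
  have hint : inner ℂ (ha'.toLp _) (hb.toLp _) = ∫ x, a x * b x ∂haar := by
    rw [L2.inner_def]
    refine integral_congr_ae ?_
    filter_upwards [MemLp.coeFn_toLp ha', MemLp.coeFn_toLp hb] with x h1 h2
    rw [h1, h2, RCLike.inner_apply, Complex.conj_conj, mul_comm]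
  rw [hint] at h
  refine h.congr_fun fun k => ?_
  rw [hcoef hb, ← inner_conj_symm, hcoef ha', fourierCoeff_conj, Complex.conj_conj]

theorem fourierCoeff_fourier_mul (f : Torus → ℂ) (j k : ℤ) :
    fourierCoeff (fun x => fourier j x * f x) k = fourierCoeff f (k - j) := by
  simp only [fourierCoeff, smul_eq_mul, ← mul_assoc, ← fourier_add]
  congr! 3 with x
  congr 1
  ring_nf

theorem Continuous.memLp_haar {f : Torus → ℂ} (hf : Continuous f) (p : ENNReal) : MemLp f p haar := by
  obtain ⟨C, hC⟩ := isCompact_univ.exists_bound_of_continuousOn hf.continuousOn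
  exact MemLp.of_bound hf.aestronglyMeasurable C (Filter.Eventually.of_forall fun x => hC x (mem_univ _))

/-- Convolution formula for the coefficients of a product. -/
theorem hasSum_fourierCoeff_conv {g f : Torus → ℂ} (hg : Continuous g) (hf : MemLp f 2 haar)
    (k : ℤ) : HasSum (fun j => fourierCoeff g (k - j) * fourierCoeff f j)
      (fourierCoeff (fun x => g x * f x) k) := by
  have h := hasSum_fourierCoeff_mul
    (Continuous.memLp_haar (f := fun x => fourier (-k) x * g x) (by fun_prop) 2) hf
  simp only [fourierCoeff_fourier_mul, sub_neg_eq_add, mul_assoc] at h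
  refine h.congr_fun fun j => ?_
  rw [neg_add_eq_sub]

end Parseval

/-! ### The matrix and the quadratic form of the control operator -/

section ControlMatrix

variable {g : Torus → ℝ}

theorem IsControlProfile.realCoeff_zero (hg : IsControlProfile g) :
    (2 * π : ℂ) * realCoeff g 0 = 1 := by
  have h := hg.integral_eq_one
  rw [integral_volume_eq] at h
  have h1 : realCoeff g 0 = ((∫ x, g x ∂haar : ℝ) : ℂ) := by
    rw [realCoeff, fourierCoeff, ← integral_complex_ofReal]
    refine integral_congr_ae (Filter.Eventually.of_forall fun x => ?_)
    simp
  rw [h1]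
  exact_mod_cast h

/-- The matrix of the control operator, completed by the identity on constants. -/
noncomputable def controlMatrix (g : Torus → ℝ) (k j : ℤ) : ℂ :=
  realCoeff g (k - j) - 2 * π * realCoeff g k * realCoeff g (-j) + if k = 0 ∧ j = 0 then 1 else 0

/-- The control operator commutes with complex conjugation of functions, since g is real. -/
theorem conj_controlMatrix (k j : ℤ) :
    starRingEnd ℂ (controlMatrix g k j) = controlMatrix g (-k) (-j) := by
  simp only [controlMatrix, map_add, map_sub, map_mul, conj_realCoeff, Complex.conj_ofReal,
    map_ofNat, neg_sub, neg_eq_zero, neg_neg, apply_ite (starRingEnd ℂ), map_one, map_zero]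
  congr 3
  ring

/-- Self-adjointness of the control operator on L². -/
theorem conj_controlMatrix_swap (k j : ℤ) :
    starRingEnd ℂ (controlMatrix g k j) = controlMatrix g j k := by
  simp only [controlMatrix, map_add, map_sub, map_mul, conj_realCoeff, Complex.conj_ofReal,
    map_ofNat, neg_sub, neg_neg, apply_ite (starRingEnd ℂ), map_one, map_zero, and_comm]
  ring

theorem one_add_abs_sub_le (k j : ℤ) :
    1 + |((k - j : ℤ) : ℝ)| ≤ (1 + |(k : ℝ)|) * (1 + |(j : ℝ)|) := by
  push_cast
  have := abs_sub (k : ℝ) j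
  nlinarith [mul_nonneg (abs_nonneg (k : ℝ)) (abs_nonneg (j : ℝ))]

/-- Multiplication by g is a convolution, which decays in k - j. The rank one term decays in k and
in j separately, hence in k - j because 1 + |k - j| ≤ (1 + |k|)(1 + |j|). -/
theorem exists_controlMatrix_decay (hg : IsSmooth g) (N : ℕ) : ∃ C : ℝ, 0 ≤ C ∧
    ∀ k j : ℤ, ‖controlMatrix g k j‖ ≤ C / (1 + |((k - j : ℤ) : ℝ)|) ^ N := by
  obtain ⟨C, hC0, hC⟩ := exists_realCoeff_decay N hg
  refine ⟨C + 2 * π * C * C + 1, by positivity, fun k j => ?_⟩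
  have h1 := hC (k - j)
  have h2 : ‖(2 * π * realCoeff g k * realCoeff g (-j) : ℂ)‖
      ≤ 2 * π * C * C / (1 + |((k - j : ℤ) : ℝ)|) ^ N := by
    have hk := hC k
    have hj := hC (-j)
    rw [Int.cast_neg, abs_neg] at hj
    rw [norm_mul, norm_mul, norm_mul, Complex.norm_real, Complex.norm_ofNat,
      Real.norm_of_nonneg Real.pi_pos.le]
    calc 2 * π * ‖realCoeff g k‖ * ‖realCoeff g (-j)‖
        ≤ 2 * π * (C / (1 + |(k : ℝ)|) ^ N) * (C / (1 + |(j : ℝ)|) ^ N) := by gcongr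
      _ = 2 * π * C * C / ((1 + |(k : ℝ)|) * (1 + |(j : ℝ)|)) ^ N := by
          rw [mul_pow]
          field_simp
      _ ≤ _ := by
          gcongr
          exact one_add_abs_sub_le k j
  have h3 : ‖(if k = 0 ∧ j = 0 then 1 else 0 : ℂ)‖ ≤ 1 / (1 + |((k - j : ℤ) : ℝ)|) ^ N := by
    split_ifs with h
    · simp [h.1, h.2]
    · rw [norm_zero]
      positivity
  rw [add_div, add_div]
  exact (norm_add_le _ _).trans (add_le_add ((norm_sub_le _ _).trans (add_le_add h1 h2)) h3)

theorem exists_controlMatrix_diag (hg : IsControlProfile g) : ∃ C : ℝ, 0 ≤ C ∧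
    ∀ k : ℤ, ‖controlMatrix g k k - realCoeff g 0‖ ≤ C / (1 + |(k : ℝ)|) := by
  obtain ⟨C, hC0, hC⟩ := exists_realCoeff_decay 1 hg.smooth
  obtain ⟨B, hB0, hB⟩ := exists_realCoeff_decay 0 hg.smooth
  refine ⟨2 * π * C * B + 1, by positivity, fun k => ?_⟩
  have e : controlMatrix g k k - realCoeff g 0
      = -(2 * π * realCoeff g k * realCoeff g (-k)) + if k = 0 then 1 else 0 := by
    simp only [controlMatrix, sub_self, and_self]
    ring
  have h1 := hC k
  have h2 := hB (-k)
  rw [pow_one] at h1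
  rw [pow_zero, div_one] at h2
  have h3 : ‖(if k = 0 then 1 else 0 : ℂ)‖ ≤ 1 / (1 + |(k : ℝ)|) := by
    split_ifs with h
    · simp [h]
    · rw [norm_zero]
      positivity
  rw [e, add_div]
  refine (norm_add_le _ _).trans (add_le_add ?_ h3)
  rw [norm_neg, norm_mul, norm_mul, norm_mul, Complex.norm_real, Complex.norm_ofNat,
    Real.norm_of_nonneg Real.pi_pos.le]
  calc 2 * π * ‖realCoeff g k‖ * ‖realCoeff g (-k)‖
      ≤ 2 * π * (C / (1 + |(k : ℝ)|)) * B := by gcongr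
    _ = _ := by ring

/-- The control operator on complex-valued functions. -/
noncomputable def complexControlOp (g : Torus → ℝ) (f : Torus → ℂ) : Torus → ℂ :=
  fun x => (g x : ℂ) * (f x - ∫ y : Torus, (g y : ℂ) * f y)

theorem IsControlProfile.continuous_ofReal (hg : IsControlProfile g) :
    Continuous fun x => (g x : ℂ) :=
  Complex.continuous_ofReal.comp hg.smooth.continuous

theorem integral_volume_complex (F : Torus → ℂ) :
    ∫ x : Torus, F x = (2 * π : ℂ) * ∫ x : Torus, F x ∂haar := by
  rw [AddCircle.integral_haarAddCircle, Complex.real_smul, ← mul_assoc]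
  push_cast
  rw [mul_inv_cancel₀ (by exact_mod_cast Real.two_pi_pos.ne'), one_mul]

/-- The average m equals 2π times the zeroth coefficient of gf, so subtracting gm is the rank one
term of the matrix. The summand at k = 0 comes from the identity added on constants. -/
theorem hasSum_complexControlOp (hg : IsControlProfile g) {f : Torus → ℂ} (hf : MemLp f 2 haar)
    (k : ℤ) : HasSum (fun j => controlMatrix g k j * fourierCoeff f j)
      (fourierCoeff (complexControlOp g f) k + if k = 0 then fourierCoeff f 0 else 0) := by
  have hgc := hg.continuous_ofReal
  have hfi : Integrable f haar := hf.integrable (by norm_num)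
  set m := ∫ y : Torus, (g y : ℂ) * f y with hm
  have h1 := hasSum_fourierCoeff_conv hgc hf k
  have h2 := (hasSum_fourierCoeff_conv hgc hf 0).mul_left (2 * π * realCoeff g k)
  have h3 : 2 * π * realCoeff g k * fourierCoeff (fun x => (g x : ℂ) * f x) 0
      = m * realCoeff g k := by
    have : fourierCoeff (fun x => (g x : ℂ) * f x) 0 = ∫ x, (g x : ℂ) * f x ∂haar := by
      rw [fourierCoeff]
      refine integral_congr_ae (Filter.Eventually.of_forall fun x => ?_)
      simp
    rw [this, hm, integral_volume_complex]
    ring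
  have h4 : fourierCoeff (complexControlOp g f) k
      = fourierCoeff (fun x => (g x : ℂ) * f x) k - m * realCoeff g k := by
    have e : complexControlOp g f
        = (fun x => (g x : ℂ) * f x) + fun x => (-m) * (g x : ℂ) := by
      ext x
      simp only [complexControlOp, Pi.add_apply, ← hm]
      ring
    rw [e, fourierCoeff.add, Pi.add_apply, fourierCoeff.const_mul, realCoeff]
    · ring
    · obtain ⟨C, hC⟩ := isCompact_univ.exists_bound_of_continuousOn hgc.continuousOn
      exact hfi.bdd_mul hgc.aestronglyMeasurable
        (Filter.Eventually.of_forall fun x => hC x (mem_univ _))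
    · exact ((Continuous.memLp_haar hgc 2).integrable (by norm_num)).const_mul _
  have h5 : HasSum (fun j => (if k = 0 ∧ j = 0 then 1 else 0) * fourierCoeff f j)
      (if k = 0 then fourierCoeff f 0 else 0) := by
    refine (hasSum_ite_eq (0 : ℤ) (if k = 0 then fourierCoeff f 0 else 0)).congr_fun fun j => ?_
    by_cases hj : j = 0 <;> by_cases hk : k = 0 <;> simp [hj, hk]
  rw [h3] at h2
  rw [h4]
  refine ((h1.sub h2).add h5).congr_fun fun j => ?_
  simp only [controlMatrix, realCoeff, zero_sub]
  ring

theorem memLp_complexControlOp (hg : IsControlProfile g) {f : Torus → ℂ} (hf : MemLp f 2 haar) :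
    MemLp (complexControlOp g f) 2 haar := by
  have hgc := hg.continuous_ofReal
  obtain ⟨C, hC⟩ := isCompact_univ.exists_bound_of_continuousOn hgc.continuousOn
  have h1 := hf.sub (memLp_const (∫ y : Torus, (g y : ℂ) * f y))
  refine MemLp.of_le_mul (c := C) h1
    (hgc.aestronglyMeasurable.mul h1.aestronglyMeasurable)
    (Filter.Eventually.of_forall fun x => ?_)
  rw [complexControlOp, norm_mul]
  exact mul_le_mul_of_nonneg_right (hC x (mem_univ _)) (norm_nonneg _)

/-- The quadratic form of the control operator. -/
theorem hasSum_conj_mul_complexControlOp (hg : IsControlProfile g) {f : Torus → ℂ}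
    (hf : MemLp f 2 haar) :
    HasSum (fun k => starRingEnd ℂ (fourierCoeff f k) * fourierCoeff (complexControlOp g f) k)
      ((∫ x, g x * ‖f x - ∫ y : Torus, (g y : ℂ) * f y‖ ^ 2 ∂haar : ℝ) : ℂ) := by
  have hgc := hg.continuous_ofReal
  set m := ∫ y : Torus, (g y : ℂ) * f y with hm
  have hfi : Integrable f haar := hf.integrable (by norm_num)
  have hb := memLp_complexControlOp hg hf
  have h := hasSum_fourierCoeff_mul (a := fun x => starRingEnd ℂ (f x)) hf.star hb
  simp only [fourierCoeff_conj, neg_neg] at h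
  have hbi : Integrable (complexControlOp g f) haar := hb.integrable (by norm_num)
  -- Since g has integral one, the control conserves mass. Thus f may be replaced by f - m in the
  -- left factor, which makes the form a weighted square.
  have hmean : ∫ x, complexControlOp g f x ∂haar = 0 := by
    have h1 : Integrable (fun x => (g x : ℂ) * f x) haar := by
      obtain ⟨C, hC⟩ := isCompact_univ.exists_bound_of_continuousOn hgc.continuousOn
      exact hfi.bdd_mul hgc.aestronglyMeasurable
        (Filter.Eventually.of_forall fun x => hC x (mem_univ _))
    have h2 : Integrable (fun x => (g x : ℂ) * m) haar :=
      ((Continuous.memLp_haar hgc 2).integrable (by norm_num)).mul_const _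
    have h3 : (2 * π : ℂ) * ∫ x, (g x : ℂ) ∂haar = 1 := by
      rw [← integral_volume_complex, integral_complex_ofReal, hg.integral_eq_one, Complex.ofReal_one]
    have h4 := integral_volume_complex fun y => (g y : ℂ) * f y
    rw [← hm] at h4
    simp only [complexControlOp, ← hm, mul_sub]
    rw [integral_sub h1 h2, integral_mul_const]
    have hπ : (2 * π : ℂ) ≠ 0 := by exact_mod_cast Real.two_pi_pos.ne'
    refine mul_left_cancel₀ hπ ?_
    rw [mul_sub, ← h4, ← mul_assoc, h3]
    ring
  have hval : ∫ x, starRingEnd ℂ (f x) * complexControlOp g f x ∂haar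
      = ((∫ x, g x * ‖f x - m‖ ^ 2 ∂haar : ℝ) : ℂ) := by
    have h1 : ∀ x, starRingEnd ℂ (f x) * complexControlOp g f x
        = ((g x * ‖f x - m‖ ^ 2 : ℝ) : ℂ) + starRingEnd ℂ m * complexControlOp g f x := by
      intro x
      have h2 : ((‖f x - m‖ ^ 2 : ℝ) : ℂ) = starRingEnd ℂ (f x - m) * (f x - m) := by
        rw [← Complex.normSq_eq_norm_sq, Complex.normSq_eq_conj_mul_self]
      rw [Complex.ofReal_mul, h2, map_sub]
      simp only [complexControlOp, ← hm]
      ring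
    have h3 : Integrable (fun x => starRingEnd ℂ (f x) * complexControlOp g f x) haar :=
      hf.star.integrable_mul hb
    have h4 : Integrable (fun x => ((g x * ‖f x - m‖ ^ 2 : ℝ) : ℂ)) haar := by
      refine (h3.sub (hbi.const_mul (starRingEnd ℂ m))).congr
        (Filter.Eventually.of_forall fun x => ?_)
      simp only [Pi.sub_apply, h1]
      ring
    simp only [h1]
    rw [integral_add h4 (hbi.const_mul _), integral_const_mul, hmean, mul_zero, add_zero,
      integral_complex_ofReal]
  rwa [hval] at h

end ControlMatrix

/-! ### The control operator in weighted coefficients -/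

section WeightedControl

/-- Peetre's inequality. A quotient of weights costs a fixed power of 1 + |l - k|, which the rapid
decay of `controlMatrix` absorbs. -/
theorem weight_div_le {s : ℝ} (hs : 0 ≤ s) (l k : ℤ) :
    weight s l / weight s k ≤ (1 + |((l - k : ℤ) : ℝ)|) ^ ⌈s⌉₊ := by
  have h1 : 1 + |(l : ℝ)| ≤ (1 + |((l - k : ℤ) : ℝ)|) * (1 + |(k : ℝ)|) := by
    have := one_add_abs_sub_le (l - k) (-k)
    simpa using this
  have h2 : (1 : ℝ) ≤ 1 + |((l - k : ℤ) : ℝ)| := by linarith [abs_nonneg ((l - k : ℤ) : ℝ)]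
  rw [div_le_iff₀ (weight_pos s k)]
  calc weight s l ≤ ((1 + |((l - k : ℤ) : ℝ)|) * (1 + |(k : ℝ)|)) ^ s :=
        Real.rpow_le_rpow (by positivity) h1 hs
    _ = (1 + |((l - k : ℤ) : ℝ)|) ^ s * weight s k :=
        Real.mul_rpow (by positivity) (by positivity)
    _ ≤ _ := by
        refine mul_le_mul_of_nonneg_right ?_ (weight_pos s k).le
        rw [← Real.rpow_natCast]
        exact Real.rpow_le_rpow_of_exponent_le h2 (Nat.le_ceil s)

/-- The matrix of the control operator in the weighted coefficients. -/
noncomputable def weightedControlMatrix (g : Torus → ℝ) (s : ℝ) (l k : ℤ) : ℂ :=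
  ((weight s l / weight s k : ℝ) : ℂ) * controlMatrix g l k

variable {g : Torus → ℝ} {s : ℝ}

theorem weightedControlMatrix_zero (l k : ℤ) :
    weightedControlMatrix g 0 l k = controlMatrix g l k := by
  simp [weightedControlMatrix, weight]

theorem weightedControlMatrix_diag (k : ℤ) :
    weightedControlMatrix g s k k = controlMatrix g k k := by
  rw [weightedControlMatrix, div_self (weight_pos s k).ne', Complex.ofReal_one, one_mul]

theorem exists_weightedControlMatrix_decay (hg : IsSmooth g) (hs : 0 ≤ s) (N : ℕ) :
    ∃ C : ℝ, 0 ≤ C ∧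
      ∀ l k : ℤ, ‖weightedControlMatrix g s l k‖ ≤ C / (1 + |((l - k : ℤ) : ℝ)|) ^ N := by
  obtain ⟨C, hC0, hC⟩ := exists_controlMatrix_decay hg (⌈s⌉₊ + N)
  refine ⟨C, hC0, fun l k => ?_⟩
  have h0 : 0 ≤ weight s l / weight s k := div_nonneg (weight_pos s l).le (weight_pos s k).le
  rw [weightedControlMatrix, norm_mul, Complex.norm_real, Real.norm_of_nonneg h0]
  calc weight s l / weight s k * ‖controlMatrix g l k‖
      ≤ (1 + |((l - k : ℤ) : ℝ)|) ^ ⌈s⌉₊ * (C / (1 + |((l - k : ℤ) : ℝ)|) ^ (⌈s⌉₊ + N)) :=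
        mul_le_mul (weight_div_le hs l k) (hC l k) (norm_nonneg _) (by positivity)
    _ = C / (1 + |((l - k : ℤ) : ℝ)|) ^ N := by
        rw [pow_add]
        field_simp

theorem exists_hasFreqMatrix (hg : IsSmooth g) (hs : 0 ≤ s) :
    ∃ G, HasFreqMatrix G (weightedControlMatrix g s) := by
  obtain ⟨C, hC0, hC⟩ := exists_weightedControlMatrix_decay hg hs 2
  have h : ∀ i j : Mode, ‖(if i.2 = j.2 then weightedControlMatrix g s i.1 j.1 else 0 : ℂ)‖
      ≤ bandWeight C (i - j) := by
    intro i j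
    unfold bandWeight
    split_ifs
    · rw [mul_one_div]
      exact hC i.1 j.1
    · rw [norm_zero]
      positivity
  exact ⟨bandCLM _ (bandWeight C) h, fun i j => bandCLM_unitVec (summable_bandWeight C) h i j⟩

theorem HasFreqMatrix.hasSum {G : EllTwo Mode →L[ℂ] EllTwo Mode} {γ : ℤ → ℤ → ℂ}
    (hG : HasFreqMatrix G γ) (x : EllTwo Mode) (k : ℤ) (c : Fin 2) :
    HasSum (fun j => γ k j * x (j, c)) (G x (k, c)) := by
  have h := hasSum_entries G x (k, c)
  rw [← (Prod.mk_left_injective c).hasSum_iff] at h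
  · refine h.congr_fun fun j => ?_
    simp [hG _ _]
  · rintro ⟨j, d⟩ hj
    have hd : c ≠ d := fun hcd => hj ⟨j, by rw [hcd]⟩
    simp [hG _ _, hd]

end WeightedControl

/-! ### Injectivity of the control on finite support and surjectivity of the Gramian -/

section QuadraticForm

variable {g : Torus → ℝ} {G : EllTwo Mode →L[ℂ] EllTwo Mode}

/-- The integral alone vanishes for constant f; the terms ‖x (0, c)‖², due to the identity added on
constants, detect the mean. -/
theorem inner_control_eq (hg : IsControlProfile g) (hG : HasFreqMatrix G (controlMatrix g))
    {x : EllTwo Mode} {f : Fin 2 → Torus → ℂ} (hf : ∀ c, MemLp (f c) 2 haar)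
    (hx : ∀ k c, fourierCoeff (f c) k = x (k, c)) :
    inner ℂ x (G x) = ((∑ c, (∫ t, g t * ‖f c t - ∫ y : Torus, (g y : ℂ) * f c y‖ ^ 2 ∂haar
      + ‖x (0, c)‖ ^ 2) : ℝ) : ℂ) := by
  have hcoord : ∀ k c, G x (k, c)
      = fourierCoeff (complexControlOp g (f c)) k + if k = 0 then x (0, c) else 0 := by
    intro k c
    have h1 := hG.hasSum x k c
    have h2 := hasSum_complexControlOp hg (hf c) k
    simp only [hx] at h2
    exact h1.unique h2
  have h1 : HasSum (fun k : ℤ => ∑ c, inner ℂ (x (k, c)) (G x (k, c))) (inner ℂ x (G x)) :=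
    (lp.hasSum_inner x (G x)).prod_fiberwise fun k => hasSum_fintype _
  refine h1.unique ?_
  push_cast
  refine hasSum_sum fun c _ => ?_
  have h2 := hasSum_conj_mul_complexControlOp hg (hf c)
  have h3 := hasSum_ite_eq (0 : ℤ) ((‖x (0, c)‖ : ℂ) ^ 2)
  refine (h2.add h3).congr_fun fun k => ?_
  rw [hcoord, hx, RCLike.inner_apply]
  split_ifs with hk
  · rw [hk, ← Complex.conj_mul']
    ring
  · ring

theorem re_inner_control_nonneg (hg : IsControlProfile g) (hG : HasFreqMatrix G (controlMatrix g))
    (x : EllTwo Mode) : 0 ≤ (inner ℂ x (G x)).re := by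
  let f : Fin 2 → Lp ℂ 2 haar := fun c => (fourierBasis (T := 2 * π)).repr.symm
    (weightedComp (fun k : ℤ => ((k, c) : Mode)) (Prod.mk_left_injective c) (fun _ => 1) 1 zero_le_one
      (fun _ => by simp) x)
  have hx : ∀ k c, fourierCoeff (f c) k = x (k, c) := by
    intro k c
    rw [← fourierBasis_repr, LinearIsometryEquiv.apply_symm_apply, weightedComp_apply, one_mul]
  rw [inner_control_eq hg hG (f := fun c => f c) (fun c => Lp.memLp (f c)) hx, Complex.ofReal_re]
  refine Finset.sum_nonneg fun c _ => add_nonneg (integral_nonneg fun t => ?_) (by positivity)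
  exact mul_nonneg (hg.nonneg t) (by positivity)

theorem fourierCoeff_sum_fourier (s : Finset ℤ) (a : ℤ → ℂ) (k : ℤ) :
    fourierCoeff (fun x : Torus => ∑ j ∈ s, a j * fourier j x) k = if k ∈ s then a k else 0 := by
  have h := fourierCoeff.sum s (fun j (x : Torus) => a j * fourier j x) fun j _ =>
    ((Continuous.memLp_haar (f := fun x : Torus => a j * fourier j x) (by fun_prop) 2).integrable
      (by norm_num))
  have e : (fun x : Torus => ∑ j ∈ s, a j * fourier j x)
      = ∑ j ∈ s, fun x : Torus => a j * fourier j x := by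
    ext x
    simp
  rw [e, h, Finset.sum_apply]
  simp only [fourierCoeff.const_mul, fourierCoeff_fourier, Pi.single_apply]
  simp

/-- A trigonometric polynomial that is constant on a nonempty open set is constant. -/
theorem trigPoly_eq_of_eqOn_open {s : Finset ℤ} {a : ℤ → ℂ} {m : ℂ} {U : Set Torus}
    (hU : IsOpen U) (hne : U.Nonempty) (h : ∀ x ∈ U, ∑ j ∈ s, a j * fourier j x = m) (x : Torus) :
    ∑ j ∈ s, a j * fourier j x = m := by
  have hana : AnalyticOnNhd ℝ (fun t : ℝ => ∑ j ∈ s, a j * fourier j (t : Torus)) univ := by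
    intro t _
    refine Finset.analyticAt_fun_sum _ fun j _ => analyticAt_const.mul ?_
    have e : (fun t : ℝ => (fourier j (t : Torus) : ℂ))
        = fun t : ℝ => Complex.exp (2 * π * Complex.I * j * t / (2 * π : ℝ)) := by
      ext t
      exact fourier_coe_apply
    rw [e]
    have h1 : AnalyticAt ℝ (fun t : ℝ => (t : ℂ)) t := Complex.ofRealCLM.analyticAt t
    have h2 : AnalyticAt ℝ (fun t : ℝ => (2 * π * Complex.I * j * t / (2 * π : ℝ) : ℂ)) t :=
      (analyticAt_const.mul h1).div_const
    exact (analyticAt_cexp.restrictScalars (𝕜 := ℝ)).comp h2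
  obtain ⟨x₀, hx₀⟩ := hne
  obtain ⟨t₀, rfl⟩ := QuotientAddGroup.mk_surjective x₀
  have hev : (fun t : ℝ => ∑ j ∈ s, a j * fourier j (t : Torus)) =ᶠ[nhds t₀] fun _ => m := by
    have hmem : (fun t : ℝ => (t : Torus)) ⁻¹' U ∈ nhds t₀ :=
      (hU.preimage (AddCircle.continuous_mk' _)).mem_nhds hx₀
    filter_upwards [hmem] with t ht
    exact h _ ht
  obtain ⟨t, rfl⟩ := QuotientAddGroup.mk_surjective x
  exact congrFun (hana.eq_of_eventuallyEq (fun _ _ => analyticAt_const) hev) t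

/-- The control operator is injective on trigonometric polynomials. -/
theorem eq_zero_of_control_eq_zero (hg : IsControlProfile g)
    (hG : HasFreqMatrix G (controlMatrix g)) (x : EllTwo Mode) (hfin : {i | x i ≠ 0}.Finite)
    (hx : G x = 0) : x = 0 := by
  let s : Finset ℤ := hfin.toFinset.image Prod.fst
  have hs : ∀ k c, k ∉ s → x (k, c) = 0 := by
    intro k c hk
    by_contra hne
    exact hk (Finset.mem_image.mpr ⟨(k, c), by simpa using hne, rfl⟩)
  let f : Fin 2 → Torus → ℂ := fun c t => ∑ j ∈ s, x (j, c) * fourier j t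
  have hfc : ∀ c, Continuous (f c) := fun c => by fun_prop
  have hcoef : ∀ k c, fourierCoeff (f c) k = x (k, c) := by
    intro k c
    rw [fourierCoeff_sum_fourier s (fun j => x (j, c))]
    split_ifs with hk
    · rfl
    · exact (hs k c hk).symm
  have h := inner_control_eq hg hG (fun c => Continuous.memLp_haar (hfc c) 2) hcoef
  rw [hx, inner_zero_right, eq_comm, Complex.ofReal_eq_zero] at h
  have hint0 : ∀ c, 0 ≤ ∫ t, g t * ‖f c t - ∫ y : Torus, (g y : ℂ) * f c y‖ ^ 2 ∂haar :=
    fun c => integral_nonneg fun t => mul_nonneg (hg.nonneg t) (by positivity)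
  rw [Finset.sum_eq_zero_iff_of_nonneg fun c _ => add_nonneg (hint0 c) (by positivity)] at h
  obtain ⟨x₀, hx₀⟩ : ∃ t, g t ≠ 0 := by
    by_contra! hz
    have := hg.integral_eq_one
    simp [hz] at this
  ext ⟨k, c⟩
  have hc := h c (Finset.mem_univ c)
  have h1 : ∫ t, g t * ‖f c t - ∫ y : Torus, (g y : ℂ) * f c y‖ ^ 2 ∂haar = 0 := by
    nlinarith [hint0 c, sq_nonneg ‖x (0, c)‖]
  have h2 : x (0, c) = 0 := by
    have : ‖x (0, c)‖ ^ 2 = 0 := by nlinarith [hint0 c, sq_nonneg ‖x (0, c)‖]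
    simpa using this
  set m := ∫ y : Torus, (g y : ℂ) * f c y
  have hcont : Continuous fun t => g t * ‖f c t - m‖ ^ 2 :=
    hg.smooth.continuous.mul (((hfc c).sub continuous_const).norm.pow 2)
  have hzero : ∀ t, g t * ‖f c t - m‖ ^ 2 = 0 := by
    have hi : Integrable (fun t => g t * ‖f c t - m‖ ^ 2) haar := by
      obtain ⟨C, hC⟩ := isCompact_univ.exists_bound_of_continuousOn hcont.continuousOn
      exact Integrable.of_bound hcont.aestronglyMeasurable C
        (Filter.Eventually.of_forall fun x => hC x (mem_univ _))
    have h3 := (integral_eq_zero_iff_of_nonneg (μ := haar)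
      (fun t => mul_nonneg (hg.nonneg t) (by positivity)) hi).mp h1
    have h4 := Continuous.ae_eq_iff_eq haar hcont continuous_zero |>.mp h3
    exact fun t => congrFun h4 t
  -- f equals m where g ≠ 0, a nonempty open set, and trigonometric polynomials are analytic.
  have hconst : f c = fun _ => m := by
    funext t
    refine trigPoly_eq_of_eqOn_open (U := {t | g t ≠ 0})
      (isOpen_ne_fun hg.smooth.continuous continuous_const) ⟨x₀, hx₀⟩ (fun t ht => ?_) t
    have := (mul_eq_zero.mp (hzero t)).resolve_left ht
    exact sub_eq_zero.mp (norm_eq_zero.mp (pow_eq_zero_iff two_ne_zero |>.mp this))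
  change x (k, c) = 0
  by_cases hk : k = 0
  · rw [hk, h2]
  · rw [← hcoef, hconst]
    have := fourierCoeff_sum_fourier {0} (fun _ => m) k
    simpa [hk] using this

/-- Surjectivity of the Gramian in every Sobolev space. -/
theorem gram_kdv_surjective {α : ℝ} (hα : α < 0) (μ ζ η : ℝ) (hg : IsControlProfile g) {T s : ℝ}
    (hT : 0 < T) (hs : 0 ≤ s) (hG : HasFreqMatrix G (weightedControlMatrix g s)) :
    Function.Surjective ((kdvDispersion α μ ζ η hα.ne).gram G T) := by
  set D := kdvDispersion α μ ζ η hα.ne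
  -- Needed for r = s at time T and for r = 0 at every positive time, since the injectivity argument
  -- uses a kernel at a shorter time.
  have hcomp : ∀ {r : ℝ} {G' : EllTwo Mode →L[ℂ] EllTwo Mode}, 0 ≤ r →
      HasFreqMatrix G' (weightedControlMatrix g r) → ∀ {T : ℝ}, 0 < T →
      ∃ K : EllTwo Mode →L[ℂ] EllTwo Mode, IsCompactOperator K ∧
        D.gram G' T = (T * realCoeff g 0) • ContinuousLinearMap.id ℂ (EllTwo Mode) + K := by
    intro r G' hr hG' T hT
    obtain ⟨C₁, hC₁, h1⟩ := exists_weightedControlMatrix_decay hg.smooth hr 3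
    obtain ⟨C₂, hC₂, h2⟩ := exists_controlMatrix_diag hg
    obtain ⟨C₃, hC₃, h3⟩ := exists_norm_cross_kdv_le hα μ ζ η hT.le
    exact D.exists_compact_gram hG' hT.le hC₁ hC₂ hC₃ h1
      (fun k => by rw [weightedControlMatrix_diag]; exact h2 k) h3
  have hc0 : ∀ {T : ℝ}, 0 < T → (T * realCoeff g 0 : ℂ) ≠ 0 := fun hT =>
    mul_ne_zero (by exact_mod_cast hT.ne') (right_ne_zero_of_mul (a := (2 * π : ℂ))
      (by rw [hg.realCoeff_zero]; exact one_ne_zero))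
  obtain ⟨G₀, hG₀'⟩ := exists_hasFreqMatrix hg.smooth (le_refl (0 : ℝ))
  have hG₀ : HasFreqMatrix G₀ (controlMatrix g) := fun i j => by
    rw [hG₀' i j, weightedControlMatrix_zero]
  have hinj₀ : ∀ x, D.gram G₀ T x = 0 → x = 0 := by
    intro x hx
    refine D.gram_injective (inner_map_eq_of_entries fun i j => ?_) (re_inner_control_nonneg hg hG₀)
      (eq_zero_of_control_eq_zero hg hG₀) (fun T hT => ?_) hT hx
    · rw [hG₀, hG₀, apply_ite (starRingEnd ℂ), conj_controlMatrix_swap, map_zero]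
      simp only [eq_comm]
    · obtain ⟨K, hK, hKe⟩ := hcomp le_rfl hG₀' hT
      exact finiteDimensional_ker_of_compact (hc0 hT) hK hKe
  obtain ⟨K, hK, hKe⟩ := hcomp hs hG hT
  refine surjective_of_injective_of_compact (hc0 hT) hK hKe fun x hx => ?_
  have hw : ∀ i : Mode, ‖((weight s i.1 : ℝ) : ℂ)⁻¹‖ ≤ 1 := by
    intro i
    rw [norm_inv, Complex.norm_real, Real.norm_of_nonneg (weight_pos s i.1).le]
    exact inv_le_one_of_one_le₀ (Real.one_le_rpow (by linarith [abs_nonneg (i.1 : ℝ)]) hs)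
  -- The inclusion of H^s into L² in weighted coordinates. It commutes with the group and carries G
  -- to G₀, so injectivity passes from s = 0 to s; G itself need not be symmetric.
  let W := weightedComp id Function.injective_id (fun i : Mode => ((weight s i.1 : ℝ) : ℂ)⁻¹) 1
    zero_le_one hw
  have hW : ∀ x (i : Mode), W x i = ((weight s i.1 : ℝ) : ℂ)⁻¹ * x i := fun _ _ => rfl
  have hne : ∀ k, ((weight s k : ℝ) : ℂ) ≠ 0 := fun k => by exact_mod_cast (weight_pos s k).ne'
  have h1 := D.intertwine_gram (G := G₀) (G' := G) (W := W) (fun y => ?_) (fun t y => ?_) T x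
  · rw [hx, map_zero] at h1
    have h2 := hinj₀ _ h1.symm
    ext i
    have h3 : W x i = 0 := by rw [h2]; rfl
    rw [hW] at h3
    exact (mul_eq_zero.mp h3).resolve_left (inv_ne_zero (hne i.1))
  · ext ⟨k, c⟩
    rw [hW]
    refine ((hG.hasSum y k c).mul_left _).unique ((hG₀.hasSum (W y) k c).congr_fun fun j => ?_)
    rw [hW, weightedControlMatrix]
    have := hne k
    have := hne j
    push_cast
    field_simp
  · ext ⟨k, c⟩
    rw [hW, D.group_apply, D.group_apply, Finset.mul_sum]
    refine Finset.sum_congr rfl fun d _ => ?_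
    rw [hW]
    ring

end QuadraticForm

/-! ### From weighted coefficients back to real functions -/

section Synthesis

variable {s : ℝ}

theorem fhat_neg (f : L2Torus) (k : ℤ) : fhat f (-k) = starRingEnd ℂ (fhat f k) :=
  (conj_realCoeff (fun x => f x) k).symm

theorem integral_eq_fhat_zero (f : L2Torus) :
    ((∫ x : Torus, f x : ℝ) : ℂ) = (2 * π : ℂ) * fhat f 0 := by
  rw [integral_volume_eq, fhat, fourierCoeff]
  push_cast
  rw [← integral_complex_ofReal]
  congr 1
  refine integral_congr_ae (Filter.Eventually.of_forall fun x => ?_)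
  simp

theorem HsZero.fhat_zero_eq_zero (f : HsZero s) : fhat f.toL2 0 = 0 := by
  have h := integral_eq_fhat_zero f.toL2
  have h1 : ∫ x : Torus, f.toL2 x = 0 := f.2.2
  rw [h1, Complex.ofReal_zero, eq_comm] at h
  exact (mul_eq_zero.mp h).resolve_left (by exact_mod_cast Real.two_pi_pos.ne')

theorem besselCoeff_apply (f : HsZero s) (k : ℤ) :
    besselCoeff s f k = ((weight s k : ℝ) : ℂ) * fhat f.toL2 k := rfl

theorem weight_neg (k : ℤ) : weight s (-k) = weight s k := by simp [weight]

theorem norm_inv_weight_le (hs : 0 ≤ s) (k : ℤ) : ‖((weight s k : ℝ) : ℂ)⁻¹‖ ≤ 1 := by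
  rw [norm_inv, Complex.norm_real, Real.norm_of_nonneg (weight_pos s k).le]
  exact inv_le_one_of_one_le₀ (Real.one_le_rpow (by linarith [abs_nonneg (k : ℝ)]) hs)

theorem weight_ne_zero (k : ℤ) : ((weight s k : ℝ) : ℂ) ≠ 0 := by
  exact_mod_cast (weight_pos s k).ne'

/-- Hermitian square summable families without mean are the weighted coefficients of functions
in `H^s₀`. -/
theorem exists_besselCoeff_eq (hs : 0 ≤ s) (a : EllTwo ℤ) (h0 : a 0 = 0)
    (hsymm : ∀ k, a (-k) = starRingEnd ℂ (a k)) : ∃ f : HsZero s, besselCoeff s f = a := by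
  let b : EllTwo ℤ := weightedComp id Function.injective_id
    (fun k : ℤ => ((weight s k : ℝ) : ℂ)⁻¹) 1 zero_le_one (norm_inv_weight_le hs) a
  have hb : ∀ k, b k = ((weight s k : ℝ) : ℂ)⁻¹ * a k := fun _ => rfl
  let F : Lp ℂ 2 haar := (fourierBasis (T := 2 * π)).repr.symm b
  have hF : ∀ k, fourierCoeff F k = b k := by
    intro k
    rw [← fourierBasis_repr, LinearIsometryEquiv.apply_symm_apply]
  have hFm : MemLp F 2 haar := Lp.memLp F
  -- The coefficients b are Hermitian, so replacing F by its real part does not change them.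
  have hre : MemLp (fun x => (F x).re) 2 haar := hFm.re
  let f : L2Torus := hre.toLp _
  have hf : ∀ k, fhat f k = b k := by
    intro k
    have h1 : (fun x : Torus => ((f x : ℝ) : ℂ)) =ᵐ[haar]
        (fun x => (1 / 2 : ℂ) * F x) + fun x => (1 / 2 : ℂ) * starRingEnd ℂ (F x) := by
      filter_upwards [MemLp.coeFn_toLp hre] with x hx
      rw [hx, Pi.add_apply, Complex.re_eq_add_conj]
      ring
    have hi : Integrable F haar := hFm.integrable (by norm_num)
    have hi' : Integrable (fun x => starRingEnd ℂ (F x)) haar :=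
      MemLp.integrable (q := 2) (by norm_num) hFm.star
    rw [fhat, fourierCoeff_congr_ae h1, fourierCoeff.add (hi.const_mul _) (hi'.const_mul _),
      Pi.add_apply, fourierCoeff.const_mul, fourierCoeff.const_mul, fourierCoeff_conj, hF, hF,
      hb, hb, hsymm, weight_neg, map_mul, map_inv₀, Complex.conj_conj, Complex.conj_ofReal]
    ring
  have hfb : ∀ k, ((weight s k : ℝ) : ℂ) * fhat f k = a k := by
    intro k
    rw [hf, hb, mul_inv_cancel_left₀ (weight_ne_zero k)]
  refine ⟨⟨f, ?_, ?_⟩, ?_⟩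
  · simp only [hfb]
    exact lp.memℓp a
  · have h := integral_eq_fhat_zero f
    rw [hf, hb, h0, mul_zero, mul_zero] at h
    exact_mod_cast h
  · ext k
    exact hfb k

/-- The factor `1 / 2` off the zero frequency. -/
noncomputable def halfOffZero (k : ℤ) : ℂ := if k = 0 then 0 else 1 / 2

theorem norm_halfOffZero_le (k : ℤ) : ‖halfOffZero k‖ ≤ 1 := by
  unfold halfOffZero
  split_ifs
  · simp
  · norm_num

theorem conj_halfOffZero (k : ℤ) : starRingEnd ℂ (halfOffZero k) = halfOffZero k := by
  unfold halfOffZero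
  split_ifs
  · simp
  · rw [map_div₀, map_one, map_ofNat]

/-- The weighted coefficients of the real part of one component, with the mean removed. -/
noncomputable def realPart (c : Fin 2) (x : EllTwo Mode) : EllTwo ℤ :=
  weightedComp (fun k : ℤ => ((k, c) : Mode)) (Prod.mk_left_injective c) halfOffZero 1 zero_le_one
      norm_halfOffZero_le x
    + star (weightedComp (fun k : ℤ => ((-k, c) : Mode))
      ((Prod.mk_left_injective c).comp neg_injective) halfOffZero 1 zero_le_one
      norm_halfOffZero_le x)

theorem realPart_apply (c : Fin 2) (x : EllTwo Mode) (k : ℤ) :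
    realPart c x k = halfOffZero k * (x (k, c) + starRingEnd ℂ (x (-k, c))) := by
  have h : realPart c x k
      = halfOffZero k * x (k, c) + starRingEnd ℂ (halfOffZero k * x (-k, c)) := rfl
  rw [h, map_mul, conj_halfOffZero]
  ring

theorem continuous_realPart (c : Fin 2) : Continuous (realPart c) :=
  (ContinuousLinearMap.continuous _).add (continuous_star.comp (ContinuousLinearMap.continuous _))

theorem exists_realize (hs : 0 ≤ s) (c : Fin 2) (x : EllTwo Mode) :
    ∃ f : HsZero s, besselCoeff s f = realPart c x := by
  refine exists_besselCoeff_eq hs _ ?_ fun k => ?_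
  · simp [realPart_apply, halfOffZero]
  · simp only [realPart_apply, map_mul, map_add, conj_halfOffZero, Complex.conj_conj, neg_neg]
    have : halfOffZero (-k) = halfOffZero k := by simp [halfOffZero]
    rw [this]
    ring

/-- The real-valued function in `H^s₀` of one component. -/
noncomputable def realize (hs : 0 ≤ s) (c : Fin 2) (x : EllTwo Mode) : HsZero s :=
  (exists_realize hs c x).choose

theorem besselCoeff_realize (hs : 0 ≤ s) (c : Fin 2) (x : EllTwo Mode) :
    besselCoeff s (realize hs c x) = realPart c x :=
  (exists_realize hs c x).choose_spec

theorem isometry_besselCoeff (s : ℝ) : Isometry (besselCoeff s) :=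
  AddMonoidHomClass.isometry_of_norm _ fun _ => rfl

theorem continuous_realize (hs : 0 ≤ s) (c : Fin 2) :
    Continuous (realize hs c) := by
  rw [(isometry_besselCoeff s).isEmbedding.isInducing.continuous_iff]
  have : besselCoeff s ∘ realize hs c = realPart c := funext fun x => besselCoeff_realize hs c x
  rw [this]
  exact continuous_realPart c

theorem fhat_realize (hs : 0 ≤ s) (c : Fin 2) (x : EllTwo Mode) (k : ℤ) :
    fhat (realize hs c x).toL2 k = ((weight s k : ℝ) : ℂ)⁻¹ * realPart c x k := by
  rw [← besselCoeff_realize hs, besselCoeff_apply, inv_mul_cancel_left₀ (weight_ne_zero k)]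

theorem memℓp_pair (a : Fin 2 → EllTwo ℤ) : Memℓp (fun i : Mode => a i.2 i.1) 2 := by
  rw [memℓp_two_iff, summable_prod_of_nonneg fun _ => by positivity]
  refine ⟨fun k => Summable.of_finite, ?_⟩
  simp only [tsum_fintype]
  exact summable_sum fun c _ => memℓp_two_iff.mp (lp.memℓp (a c))

/-- The weighted coefficients of a pair of functions. -/
noncomputable def pairCoeff (w : Fin 2 → HsZero s) : EllTwo Mode :=
  ⟨fun i => besselCoeff s (w i.2) i.1, memℓp_pair fun c => besselCoeff s (w c)⟩

/-- The coefficients of a real function without mean are Hermitian and vanish at zero, so `realPart`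
leaves them unchanged. The end states of the trajectory are recovered in this way. -/
theorem realize_pairCoeff (hs : 0 ≤ s) (w : Fin 2 → HsZero s) (c : Fin 2) :
    realize hs c (pairCoeff w) = w c := by
  apply besselCoeff_injective s
  rw [besselCoeff_realize]
  ext k
  have h : ∀ k, pairCoeff w (k, c) = ((weight s k : ℝ) : ℂ) * fhat (w c).toL2 k := fun _ => rfl
  rw [realPart_apply, h, h, besselCoeff_apply, fhat_neg, weight_neg, map_mul, Complex.conj_conj,
    Complex.conj_ofReal]
  by_cases hk : k = 0
  · rw [hk, (w c).fhat_zero_eq_zero]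
    simp
  · rw [halfOffZero, if_neg hk]
    ring

end Synthesis

/-! ### Controlled trajectories and the weak formulation -/

section Trajectory

variable (D : Dispersion) (G : EllTwo Mode →L[ℂ] EllTwo Mode) (x y : EllTwo Mode)

/-- The solution with initial value `x` and control `S(t) y`. -/
noncomputable def trajectory (t : ℝ) : EllTwo Mode := D.group t (x + D.gram G t y)

theorem hasDerivAt_gram (t : ℝ) :
    HasDerivAt (fun t => D.gram G t y) (D.group (-t) (G (D.group t y))) t :=
  intervalIntegral.integral_hasDerivAt_right
    ((D.continuous_conjugate G y).intervalIntegrable _ _)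
    ((D.continuous_conjugate G y).stronglyMeasurableAtFilter _ _)
    (D.continuous_conjugate G y).continuousAt

theorem continuous_trajectory : Continuous (trajectory D G x y) :=
  D.continuous_group_comp continuous_id (continuous_const.add
    (continuous_iff_continuousAt.mpr fun t => (hasDerivAt_gram D G y t).continuousAt))

theorem hasDerivAt_trajectory (t : ℝ) (k : ℤ) (c : Fin 2) :
    HasDerivAt (fun t => trajectory D G x y t (k, c))
      (Complex.I * ∑ d, (D.symb k c d : ℂ) * trajectory D G x y t (k, d)
        + G (D.group t y) (k, c)) t := by
  have h1 : ∀ d, HasDerivAt (fun t => (x + D.gram G t y) (k, d))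
      (D.group (-t) (G (D.group t y)) (k, d)) t := fun d =>
    ((coordCLM ((k, d) : Mode)).restrictScalars ℝ).hasFDerivAt.comp_hasDerivAt t
      ((hasDerivAt_gram D G y t).const_add x)
  have h2 := HasDerivAt.fun_sum (u := Finset.univ)
    fun d _ => (D.hasDerivAt_prop k t c d).mul (h1 d)
  have h3 : G (D.group t y) (k, c)
      = ∑ d, D.prop k t c d * D.group (-t) (G (D.group t y)) (k, d) := by
    rw [← D.group_apply, D.group_group, add_neg_cancel, D.group_zero]
  have h4 : ∀ t c, trajectory D G x y t (k, c)
      = ∑ d, D.prop k t c d * (x + D.gram G t y) (k, d) := fun t c => D.group_apply t _ k c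
  simp only [h4, h3]
  refine h2.congr_deriv ?_
  simp only [Fin.sum_univ_two]
  ring

variable {D G}

/-- Conjugation turns i into -i and the reflection k ↦ -k turns the real odd symbol into its
negative. The signs cancel, so the real part solves the same equation. -/
theorem hasDerivAt_realPart_trajectory (hsymb : ∀ k c d, D.symb (-k) c d = -D.symb k c d)
    (t : ℝ) (k : ℤ) (c : Fin 2) :
    HasDerivAt (fun t => realPart c (trajectory D G x y t) k)
      (Complex.I * ∑ d, (D.symb k c d : ℂ) * realPart d (trajectory D G x y t) k
        + realPart c (G (D.group t y)) k) t := by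
  have h1 := hasDerivAt_trajectory D G x y t k c
  have h2 := (Complex.conjCLE.toContinuousLinearMap.hasFDerivAt).comp_hasDerivAt t
    (hasDerivAt_trajectory D G x y t (-k) c)
  have h3 := (h1.add h2).const_mul (halfOffZero k)
  simp only [realPart_apply]
  refine h3.congr_deriv ?_
  simp [hsymb]
  ring

end Trajectory

section WeakForm

theorem hasSum_pairing {w φ : Torus → ℝ} (hw : MemLp (fun x => (w x : ℂ)) 2 haar)
    (hφ : IsSmooth φ) :
    HasSum (fun k => 2 * π * realCoeff φ (-k) * realCoeff w k) ((pairing w φ : ℝ) : ℂ) := by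
  have h := (hasSum_fourierCoeff_mul (Continuous.memLp_haar
    (Complex.continuous_ofReal.comp hφ.continuous) 2) hw).mul_left (2 * π : ℂ)
  rw [← integral_volume_complex] at h
  have e : ∫ x : Torus, (Complex.ofReal ∘ φ) x * (w x : ℂ) = ((pairing w φ : ℝ) : ℂ) := by
    rw [pairing, ← integral_complex_ofReal]
    refine integral_congr_ae (Filter.Eventually.of_forall fun x => ?_)
    simp [mul_comm]
  rw [e] at h
  refine h.congr_fun fun k => ?_
  rw [mul_assoc]
  rfl

theorem ofReal_controlOp (g ℓ : Torus → ℝ) :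
    (fun x => ((controlOp g ℓ x : ℝ) : ℂ)) = complexControlOp g fun x => (ℓ x : ℂ) := by
  ext x
  rw [controlOp, complexControlOp]
  push_cast
  rw [← integral_complex_ofReal]
  simp only [Complex.ofReal_mul]

/-- Integration in time of a pairing whose coefficients solve ordinary differential equations. -/
theorem pairing_eq_add_integral {φ : Torus → ℝ} (hφ : IsSmooth φ) {p q : ℝ → ℝ}
    {a b : ℤ → ℝ → ℂ} {T B : ℝ}
    (hp : ∀ t, HasSum (fun k => 2 * π * realCoeff φ (-k) * a k t) (p t : ℂ))
    (hq : ∀ t, HasSum (fun k => 2 * π * realCoeff φ (-k) * b k t) (q t : ℂ))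
    (hab : ∀ k t, HasDerivAt (a k) (b k t) t) (hb : ∀ k, Continuous (b k))
    (hbound : ∀ k, ∀ t ∈ Icc 0 T, ‖b k t‖ ≤ B * (1 + |(k : ℝ)|) ^ 3) {t : ℝ} (ht : t ∈ Icc 0 T) :
    p t = p 0 + ∫ τ in (0 : ℝ)..t, q τ := by
  -- Three powers offset the growth of b, that of a third order operator; two make the dominating
  -- series summable.
  obtain ⟨C, hC0, hC⟩ := exists_realCoeff_decay 5 hφ
  have hsum : Summable fun k : ℤ => 2 * π * C * B * (1 / (1 + |(k : ℝ)|) ^ 2) :=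
    summable_one_add_abs_sq.mul_left _
  have h1 : HasSum (fun k => ∫ τ in (0 : ℝ)..t, 2 * π * realCoeff φ (-k) * b k τ)
      (∫ τ in (0 : ℝ)..t, (q τ : ℂ)) := by
    refine intervalIntegral.hasSum_integral_of_dominated_convergence
      (fun k _ => 2 * π * C * B * (1 / (1 + |(k : ℝ)|) ^ 2))
      (fun k => (continuous_const.mul (hb k)).aestronglyMeasurable)
      (fun k => Filter.Eventually.of_forall fun τ hτ => ?_)
      (Filter.Eventually.of_forall fun _ _ => hsum) intervalIntegrable_const
      (Filter.Eventually.of_forall fun τ _ => hq τ)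
    rw [uIoc_of_le ht.1] at hτ
    have h2 := hbound k τ ⟨hτ.1.le, hτ.2.trans ht.2⟩
    have h3 := hC (-k)
    rw [Int.cast_neg, abs_neg] at h3
    rw [norm_mul, norm_mul, norm_mul, Complex.norm_real, Complex.norm_ofNat,
      Real.norm_of_nonneg Real.pi_pos.le]
    calc 2 * π * ‖realCoeff φ (-k)‖ * ‖b k τ‖
        ≤ 2 * π * (C / (1 + |(k : ℝ)|) ^ 5) * (B * (1 + |(k : ℝ)|) ^ 3) := by gcongr
      _ = _ := by field_simp
  have h2 := (hp t).sub (hp 0)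
  have h3 : ∀ k, ∫ τ in (0 : ℝ)..t, 2 * π * realCoeff φ (-k) * b k τ
      = 2 * π * realCoeff φ (-k) * a k t - 2 * π * realCoeff φ (-k) * a k 0 := by
    intro k
    rw [intervalIntegral.integral_const_mul, intervalIntegral.integral_eq_sub_of_hasDerivAt
      (fun τ _ => hab k τ) ((hb k).intervalIntegrable _ _), mul_sub]
  simp only [h3] at h1
  have h4 := h2.unique h1
  rw [intervalIntegral.integral_ofReal] at h4
  have h5 : p t - p 0 = ∫ τ in (0 : ℝ)..t, q τ := by exact_mod_cast h4
  linarith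

end WeakForm

/-! ### The realised trajectory and exact controllability -/

section Solution

variable {g : Torus → ℝ} {s : ℝ} {G : EllTwo Mode →L[ℂ] EllTwo Mode}

/-- Conservation of mass, expressed by 2πĝ(0) = 1: the zero mode decouples from the others. -/
theorem controlMatrix_zero_left (hg : IsControlProfile g) {j : ℤ} (hj : j ≠ 0) :
    controlMatrix g 0 j = 0 := by
  rw [controlMatrix, hg.realCoeff_zero, if_neg fun h => hj h.2]
  simp

theorem controlMatrix_zero_right (hg : IsControlProfile g) {k : ℤ} (hk : k ≠ 0) :
    controlMatrix g k 0 = 0 := by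
  rw [← conj_controlMatrix_swap, controlMatrix_zero_left hg hk, map_zero]

theorem conj_weightedControlMatrix (k j : ℤ) :
    starRingEnd ℂ (weightedControlMatrix g s (-k) j) = weightedControlMatrix g s k (-j) := by
  rw [weightedControlMatrix, weightedControlMatrix, map_mul, conj_controlMatrix, neg_neg,
    Complex.conj_ofReal, weight_neg, weight_neg]

/-- Removing the mean commutes with the control, because the zero mode is decoupled. -/
theorem halfOffZero_mul_weightedControlMatrix (hg : IsControlProfile g) (k j : ℤ) :
    halfOffZero k * weightedControlMatrix g s k j
      = weightedControlMatrix g s k j * halfOffZero j := by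
  unfold halfOffZero weightedControlMatrix
  by_cases hk : k = 0 <;> by_cases hj : j = 0
  · simp [hk, hj]
  · simp [hk, controlMatrix_zero_left hg hj]
  · simp [hj, controlMatrix_zero_right hg hk]
  · simp [hk, hj, mul_comm]

/-- `realPart` commutes with the control: the matrix respects conjugation of functions and the
splitting off of the mean. The controlled equation thus survives taking real parts. -/
theorem hasSum_realPart_control (hg : IsControlProfile g)
    (hG : HasFreqMatrix G (weightedControlMatrix g s)) (x : EllTwo Mode) (k : ℤ) (c : Fin 2) :
    HasSum (fun j => weightedControlMatrix g s k j * realPart c x j) (realPart c (G x) k) := by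
  have h1 := hG.hasSum x k c
  have h2 := (hG.hasSum x (-k) c).mapL (Complex.conjCLE.toContinuousLinearMap)
  rw [← (Equiv.neg ℤ).hasSum_iff] at h2
  have h3 := (h1.add h2).mul_left (halfOffZero k)
  rw [realPart_apply]
  refine h3.congr_fun fun j => ?_
  have h4 : starRingEnd ℂ (weightedControlMatrix g s (-k) (-j)) = weightedControlMatrix g s k j := by
    rw [conj_weightedControlMatrix, neg_neg]
  have h5 := halfOffZero_mul_weightedControlMatrix (s := s) hg k j
  rw [realPart_apply]
  simp only [Function.comp_apply, Equiv.neg_apply, ContinuousLinearEquiv.coe_coe,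
    Complex.conjCLE_apply, map_mul, h4]
  rw [← mul_assoc, ← h5]
  ring

/-- The control operator applied to a realised function. -/
theorem realCoeff_controlOp_realize (hg : IsControlProfile g) (hs : 0 ≤ s)
    (hG : HasFreqMatrix G (weightedControlMatrix g s)) (x : EllTwo Mode) (k : ℤ) (c : Fin 2) :
    realCoeff (controlOp g (realize hs c x)) k
      = ((weight s k : ℝ) : ℂ)⁻¹ * realPart c (G x) k := by
  have h1 := (hasSum_realPart_control hg hG x k c).mul_left (((weight s k : ℝ) : ℂ)⁻¹)
  have h2 := hasSum_complexControlOp hg (memLp_ofReal (realize hs c x).toL2) k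
  have h3 : ∀ j, fourierCoeff (fun t => (((realize hs c x).toL2 t : ℝ) : ℂ)) j
      = ((weight s j : ℝ) : ℂ)⁻¹ * realPart c x j := fhat_realize hs c x
  have h4 : fourierCoeff (fun t => (((realize hs c x).toL2 t : ℝ) : ℂ)) 0 = 0 :=
    (realize hs c x).fhat_zero_eq_zero
  rw [h4, ite_self, add_zero] at h2
  rw [realCoeff, ofReal_controlOp]
  refine h2.unique (h1.congr_fun fun j => ?_)
  rw [h3, weightedControlMatrix]
  have h5 := weight_ne_zero (s := s) k
  have h6 := weight_ne_zero (s := s) j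
  push_cast
  field_simp

theorem kdvSymb_neg (α μ ζ η : ℝ) (k : ℤ) (c d : Fin 2) :
    kdvSymb α μ ζ η (-k) c d = -kdvSymb α μ ζ η k c d := by
  fin_cases c <;> fin_cases d <;> simp [kdvSymb] <;> ring

theorem abs_kdvSymb_le (α μ ζ η : ℝ) (k : ℤ) (c d : Fin 2) :
    |kdvSymb α μ ζ η k c d| ≤ (1 + |α| + |μ| + |ζ| + |η|) * (1 + |(k : ℝ)|) ^ 3 := by
  set p := 1 + |(k : ℝ)| with hp
  have hk0 := abs_nonneg (k : ℝ)
  have hp1 : 1 ≤ p := by linarith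
  have h1 : |(k : ℝ)| ≤ p ^ 3 := by
    have : p ≤ p ^ 3 := le_self_pow₀ hp1 (by norm_num)
    linarith
  have h3 : |(k : ℝ)| ^ 3 ≤ p ^ 3 := pow_le_pow_left₀ hk0 (by linarith) 3
  have hle : ∀ a b : ℝ, |a * (k : ℝ) ^ 3 - b * k| ≤ (|a| + |b|) * p ^ 3 := by
    intro a b
    refine (abs_sub _ _).trans ?_
    rw [abs_mul, abs_mul, abs_pow, add_mul]
    gcongr
  have hp3 : 0 ≤ p ^ 3 := by positivity
  have hα := mul_nonneg (abs_nonneg α) hp3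
  have hμ := mul_nonneg (abs_nonneg μ) hp3
  have hζ := mul_nonneg (abs_nonneg ζ) hp3
  have hη := mul_nonneg (abs_nonneg η) hp3
  have e0 := hle 1 μ
  have e1 := hle α ζ
  have e2 := hle 0 η
  simp only [one_mul, abs_one, zero_mul, zero_sub, abs_zero, zero_add] at e0 e2
  rw [abs_neg, abs_mul] at e2
  fin_cases c <;> fin_cases d <;> simp [kdvSymb] <;> nlinarith

/-- The realised trajectory is a weak solution with the realised control. -/
theorem isWeakSolution_realize {α : ℝ} (hα : α ≠ 0) (μ ζ η : ℝ) (hg : IsControlProfile g)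
    (hs : 0 ≤ s) (hG : HasFreqMatrix G (weightedControlMatrix g s)) (x y : EllTwo Mode) (T : ℝ) :
    IsWeakSolution α μ ζ η g T
      (fun t => realize hs 0 ((kdvDispersion α μ ζ η hα).group t y))
      (fun t => realize hs 1 ((kdvDispersion α μ ζ η hα).group t y))
      (fun t => realize hs 0 (trajectory (kdvDispersion α μ ζ η hα) G x y t))
      (fun t => realize hs 1 (trajectory (kdvDispersion α μ ζ η hα) G x y t)) := by
  set D := kdvDispersion α μ ζ η hα with hD
  intro φ hφ t ht
  let w : Fin 2 → ℝ → HsZero s := fun c t => realize hs c (trajectory D G x y t)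
  let f : Fin 2 → ℝ → HsZero s := fun c t => realize hs c (D.group t y)
  let a : Fin 2 → ℤ → ℝ → ℂ := fun c k t => fhat (w c t).toL2 k
  let r : Fin 2 → ℤ → ℝ → ℂ := fun c k t => realCoeff (controlOp g (f c t)) k
  -- The right-hand side of the equation for the unweighted Fourier coefficients.
  let b : Fin 2 → ℤ → ℝ → ℂ := fun c k t =>
    Complex.I * ∑ d, (kdvSymb α μ ζ η k c d : ℂ) * a d k t + r c k t
  have ha : ∀ c k, a c k = fun t => ((weight s k : ℝ) : ℂ)⁻¹ * realPart c (trajectory D G x y t) k :=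
    fun c k => funext fun t => fhat_realize hs c _ k
  have hr : ∀ c k, r c k = fun t => ((weight s k : ℝ) : ℂ)⁻¹ * realPart c (G (D.group t y)) k :=
    fun c k => funext fun t => realCoeff_controlOp_realize hg hs hG _ k c
  have hab : ∀ c k t, HasDerivAt (a c k) (b c k t) t := by
    intro c k t
    have h := (hasDerivAt_realPart_trajectory (D := D) (G := G) x y
      (fun k c d => kdvSymb_neg α μ ζ η k c d) t k c).const_mul (((weight s k : ℝ) : ℂ)⁻¹)
    rw [ha]
    refine h.congr_deriv ?_
    simp only [b, ha, hr]
    have : D.symb = kdvSymb α μ ζ η := rfl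
    simp only [this, Fin.sum_univ_two]
    ring
  have hcoord : ∀ (k : ℤ) {z : ℝ → EllTwo ℤ}, Continuous z → Continuous fun t => z t k :=
    fun k _ hz => (coordCLM k).continuous.comp hz
  have hctraj : ∀ c, Continuous fun t => realPart c (trajectory D G x y t) := fun c =>
    (continuous_realPart c).comp (continuous_trajectory D G x y)
  have hccon : ∀ c, Continuous fun t => realPart c (G (D.group t y)) := fun c =>
    (continuous_realPart c).comp (G.continuous.comp (D.continuous_group y))
  have hac : ∀ c k, Continuous (a c k) := fun c k => by
    rw [ha]
    exact continuous_const.mul (hcoord k (hctraj c))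
  have hrc : ∀ c k, Continuous (r c k) := fun c k => by
    rw [hr]
    exact continuous_const.mul (hcoord k (hccon c))
  have hbc : ∀ c k, Continuous (b c k) := fun c k =>
    (continuous_const.mul (continuous_finsetSum _ fun d _ => continuous_const.mul (hac d k))).add
      (hrc c k)
  have hbdd : ∀ {z : ℝ → EllTwo ℤ}, Continuous z → ∃ M, 0 ≤ M ∧ ∀ k, ∀ t ∈ Icc 0 T,
      ‖((weight s k : ℝ) : ℂ)⁻¹ * z t k‖ ≤ M := by
    intro z hz
    obtain ⟨M, hM⟩ := isCompact_Icc.exists_bound_of_continuousOn (s := Icc 0 T) hz.continuousOn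
    refine ⟨|M|, abs_nonneg _, fun k t ht => ?_⟩
    rw [norm_mul]
    have h1 := norm_inv_weight_le hs k
    have h2 := (lp.norm_apply_le_norm two_ne_zero (z t) k).trans ((hM t ht).trans (le_abs_self M))
    exact (mul_le_mul h1 h2 (norm_nonneg _) zero_le_one).trans (one_mul _).le
  choose M hM0 hM using fun c => hbdd (hctraj c)
  choose N hN0 hN using fun c => hbdd (hccon c)
  have hbound : ∀ c, ∃ B, ∀ k, ∀ t ∈ Icc 0 T, ‖b c k t‖ ≤ B * (1 + |(k : ℝ)|) ^ 3 := by
    intro c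
    set A := 1 + |α| + |μ| + |ζ| + |η| with hA
    have hA0 : 0 ≤ A := by positivity
    refine ⟨∑ d, A * M d + N c, fun k t ht => ?_⟩
    have hp : (1 : ℝ) ≤ (1 + |(k : ℝ)|) ^ 3 := one_le_pow₀ (by linarith [abs_nonneg (k : ℝ)])
    have h1 : ‖r c k t‖ ≤ N c := by
      rw [hr]
      exact hN c k t ht
    have h2 : ∀ d, ‖a d k t‖ ≤ M d := fun d => by
      rw [ha]
      exact hM d k t ht
    rw [add_mul, Finset.sum_mul]
    refine (norm_add_le _ _).trans (add_le_add ?_ ?_)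
    · rw [norm_mul, Complex.norm_I, one_mul]
      refine (norm_sum_le _ _).trans (Finset.sum_le_sum fun d _ => ?_)
      rw [norm_mul, Complex.norm_real]
      calc _ ≤ A * (1 + |(k : ℝ)|) ^ 3 * M d :=
            mul_le_mul (abs_kdvSymb_le α μ ζ η k c d) (h2 d) (norm_nonneg _) (by positivity)
        _ = _ := by ring
    · exact h1.trans (le_mul_of_one_le_right (hN0 c) hp)
  have hw : ∀ c t, MemLp (fun z => (((w c t).toL2 z : ℝ) : ℂ)) 2 haar := fun c t =>
    memLp_ofReal (w c t).toL2
  have hwp : ∀ c t, HasSum (fun k => 2 * π * realCoeff φ (-k) * a c k t)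
      ((pairing (w c t) φ : ℝ) : ℂ) := fun c t => hasSum_pairing (hw c t) hφ
  have hdx : ∀ k : ℤ, realCoeff (dx φ) (-k) = -(Complex.I * k) * realCoeff φ (-k) := by
    intro k
    rw [realCoeff_dx hφ]
    push_cast
    ring
  have hdx3 : ∀ k : ℤ, realCoeff (dx (dx (dx φ))) (-k)
      = Complex.I * k ^ 3 * realCoeff φ (-k) := by
    intro k
    rw [realCoeff_dx hφ.dx.dx, realCoeff_dx hφ.dx, realCoeff_dx hφ]
    push_cast
    linear_combination -(Complex.I * k ^ 3 * realCoeff φ (-k)) * Complex.I_sq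
  have hw1 : ∀ c t, HasSum (fun k => 2 * π * (-(Complex.I * k) * realCoeff φ (-k)) * a c k t)
      ((pairing (w c t) (dx φ) : ℝ) : ℂ) := fun c t =>
    (hasSum_pairing (hw c t) hφ.dx).congr_fun fun k => by rw [hdx]; rfl
  have hw3 : ∀ c t, HasSum (fun k => 2 * π * (Complex.I * k ^ 3 * realCoeff φ (-k)) * a c k t)
      ((pairing (w c t) (dx (dx (dx φ))) : ℝ) : ℂ) := fun c t =>
    (hasSum_pairing (hw c t) hφ.dx.dx.dx).congr_fun fun k => by rw [hdx3]; rfl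
  have hfp : ∀ c t, HasSum (fun k => 2 * π * realCoeff φ (-k) * r c k t)
      ((pairing (controlOp g (f c t)) φ : ℝ) : ℂ) := fun c t => by
    refine hasSum_pairing ?_ hφ
    rw [ofReal_controlOp]
    exact memLp_complexControlOp hg (memLp_ofReal (f c t).toL2)
  constructor
  · obtain ⟨B, hB⟩ := hbound 0
    refine pairing_eq_add_integral hφ (p := fun t => pairing (w 0 t) φ) (hwp 0) (fun t => ?_)
      (hab 0) (hbc 0) hB ht
    have h := (((hw3 0 t).add ((hw1 0 t).mul_left (μ : ℂ))).add
      ((hw1 1 t).mul_left (η : ℂ))).add (hfp 0 t)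
    push_cast
    refine h.congr_fun fun k => ?_
    simp only [b, Fin.sum_univ_two]
    simp [kdvSymb]
    ring
  · obtain ⟨B, hB⟩ := hbound 1
    refine pairing_eq_add_integral hφ (p := fun t => pairing (w 1 t) φ) (hwp 1) (fun t => ?_)
      (hab 1) (hbc 1) hB ht
    have h := ((((hw3 1 t).mul_left (α : ℂ)).add ((hw1 1 t).mul_left (ζ : ℂ))).add
      ((hw1 0 t).mul_left (η : ℂ))).add (hfp 1 t)
    push_cast
    refine h.congr_fun fun k => ?_
    simp only [b, Fin.sum_univ_two]
    simp [kdvSymb]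
    ring

theorem memLp_two_of_continuous {E : Type*} [NormedAddCommGroup E] {f : ℝ → E} (hf : Continuous f)
    (T : ℝ) : MemLp f 2 (volume.restrict (Icc 0 T)) := by
  obtain ⟨C, hC⟩ := isCompact_Icc.exists_bound_of_continuousOn (s := Icc 0 T) hf.continuousOn
  exact MemLp.of_bound hf.aestronglyMeasurable C
    ((ae_restrict_iff' measurableSet_Icc).mpr (Filter.Eventually.of_forall hC))

end Solution

end CoupledKdV

open CoupledKdV
/-- Exact controllability of the linear coupled KdV system with two mass-preserving controls. -/
theorem theorem1p1 (α μ ζ η : ℝ) (hα : α < 0)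
    (g : Torus → ℝ) (hg : IsControlProfile g)
    (T : ℝ) (hT : 0 < T) (s : ℝ) (hs : 0 ≤ s)
    (u₀ v₀ u₁ v₁ : HsZero s) :
    ∃ f h : ℝ → HsZero s,
      MemLp f 2 (volume.restrict (Icc 0 T)) ∧ MemLp h 2 (volume.restrict (Icc 0 T)) ∧
      ∃ u v : ℝ → HsZero s,
        ContinuousOn u (Icc 0 T) ∧ ContinuousOn v (Icc 0 T) ∧
        IsWeakSolution α μ ζ η g T f h u v ∧
        u 0 = u₀ ∧ v 0 = v₀ ∧ u T = u₁ ∧ v T = v₁ := by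
  obtain ⟨G, hG⟩ := exists_hasFreqMatrix hg.smooth hs
  let D := kdvDispersion α μ ζ η hα.ne
  let x₀ := pairCoeff ![u₀, v₀]
  let x₁ := pairCoeff ![u₁, v₁]
  -- The target condition S(T)(x₀ + Λ_T y) = x₁ solved for Λ_T y.
  obtain ⟨y, hy⟩ := gram_kdv_surjective hα μ ζ η hg hT hs hG (D.group (-T) x₁ - x₀)
  have h0 : trajectory D G x₀ y 0 = x₀ := by
    rw [trajectory, D.group_zero, D.gram_apply, intervalIntegral.integral_same, add_zero]
  have h1 : trajectory D G x₀ y T = x₁ := by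
    rw [trajectory, hy, add_sub_cancel, D.group_group, add_neg_cancel, D.group_zero]
  have hf : ∀ c, Continuous fun t => realize hs c (D.group t y) := fun c =>
    (continuous_realize hs c).comp (D.continuous_group y)
  have hu : ∀ c, Continuous fun t => realize hs c (trajectory D G x₀ y t) := fun c =>
    (continuous_realize hs c).comp (continuous_trajectory D G x₀ y)
  refine ⟨fun t => realize hs 0 (D.group t y), fun t => realize hs 1 (D.group t y),
    memLp_two_of_continuous (hf 0) T, memLp_two_of_continuous (hf 1) T,
    fun t => realize hs 0 (trajectory D G x₀ y t), fun t => realize hs 1 (trajectory D G x₀ y t),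
    (hu 0).continuousOn, (hu 1).continuousOn,
    isWeakSolution_realize hα.ne μ ζ η hg hs hG x₀ y T, ?_, ?_, ?_, ?_⟩
  · simp only [h0, x₀, realize_pairCoeff]; rfl
  · simp only [h0, x₀, realize_pairCoeff]; rfl
  · simp only [h1, x₁, realize_pairCoeff]; rfl
  · simp only [h1, x₁, realize_pairCoeff]; rfl
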